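/- **Setting.** For each stage $N\in\mathbb N$ let $P_{XV}$ and $P_{YW}$ be probability measures on $\mathcal X\times\mathcal V$ and $\mathcal X\times\mathcal W$ with first marginals $P_X,P_Y$, let $k$ be a measurable positive definite kernel on $\mathcal X$ with $\int\sqrt{k(x,x)}\,dP_X(x)<\infty$, and let $n_1,n_2,m_1,m_2$ be sample sizes; all of these may depend on $N$. Assume $n_1\wedge n_2\to\infty$, $n_1\asymp m_1$, $n_2\asymp m_2$, and that the null hypothesis $P_X=P_Y$ holds at every stage. Limits, $o(1)$ and $o_P(1)$ are as $N\to\infty$; a ratio with denominator $0$ is counted as $+\infty$. Let $\overline k(x,y)=k(x,y)-\mathbb E[k(x,X_2)]-\mathbb E[k(X_1,y)]+\mathbb E[k(X_1,X_2)]$ and $\overline g(x,y)=\mathbb E[\overline k(x,X_1)\overline k(y,X_1)]$ for $X,X_1,X_2,X_3$ i.i.d. from $P_X$ (which equals $P_Y$). Let $\overline k(x,y)=\sum_i\lambda_i\phi_i(x)\phi_i(y)$ be a (finite or countably infinite) spectral decomposition: the $\phi_i$ are orthonormal eigenfunctions in $L^2(P_X)$ of the integral operator of $\overline k$ with eigenvalues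 $\lambda_i$, and the series converges in $L^2(P_X\otimes P_X)$. Let $\widehat f(x)=n_1^{-1}\sum_{j\le n_1}k(\widetilde X_j,x)-n_2^{-1}\sum_{j\le n_2}k(\widetilde Y_j,x)$, where $\widetilde X_j\sim P_X$, $\widetilde Y_j\sim P_Y$ are independent samples, independent of the labeled samples $(X_j,V_j)_{j\le n_1}\sim P_{XV}$ i.i.d. and $(Y_j,W_j)_{j\le n_2}\sim P_{YW}$ i.i.d. On each of the two folds $I$ (odd indices, even indices) of the labeled sample, let $\widehat{\mathbb E}[g(X)\mid V=v]=\sum_{j\in I}w_j(v)\,g(X_j)$ be a linear smoother, with measurable weights that may depend on the training data $(X_j,V_j)_{j\in I}$ but not on $g$; likewise for $(Y,W)$. In the conditions below $(X,V)\sim P_{XV}$ and $(Y,W)\sim P_{YW}$ are new observations independent of everything else. **Assumptions.** For each fold: 1. The smoothers are affine equivariant: for all measurable $g$ and all $a,b\in\mathbb R$, almost surely $\widehat{\mathbb E}[a\,g(X)+b\mid V]=a\,\widehat{\mathbb E}[g(X)\mid V]+b$ and $\widehat{\mathbb E}[a\,g(Y)+b\mid W]=a\,\widehat{\mathbb E}[g(Y)\mid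 W]+b$. 2. $\sup_i\mathbb E[\Delta_{X,i}^2]=o(1)$ and $\sup_i\mathbb E[\Delta_{Y,i}^2]=o(1)$, where $\Delta_{X,i}=\mathbb E[\phi_i(X)\mid V]-\widehat{\mathbb E}[\phi_i(X)\mid V]$, $\Delta_{Y,i}=\mathbb E[\phi_i(Y)\mid W]-\widehat{\mathbb E}[\phi_i(Y)\mid W]$, and the expectations are over the training fold and the new observation. Moreover, for both $r=1$ and $r=2$, $$\frac{\mathbb E[\overline k(X_1,X_2)^4]+n_r\,\mathbb E[\overline k(X_1,X_2)^2\,\overline k(X_1,X_3)^2]}{n_r^2\,\{\mathbb E[\overline g(X,X)]\}^2}=o(1).$$ **Conclusion.** For each fold, $$\frac{\mathbb E\bigl[\{\mathbb E[\widehat f(X)\mid V,\widehat f]-\widehat{\mathbb E}[\widehat f(X)\mid V,\widehat f]\}^2\,\big|\,\widehat f\bigr]}{\mathrm{Var}\{\widehat f(X)\mid\widehat f\}}=o_P(1) \quad\text{and}\quad \frac{\mathbb E\bigl[\{\mathbb E[\widehat f(Y)\mid W,\widehat f]-\widehat{\mathbb E}[\widehat f(Y)\mid W,\widehat f]\}^2\,\big|\,\widehat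 f\bigr]}{\mathrm{Var}\{\widehat f(Y)\mid\widehat f\}}=o_P(1),$$ where, given $\widehat f$, the expectations are over the training fold and the new observation. -/

import Mathlib

open MeasureTheory ProbabilityTheory Filter Topology Asymptotics
open scoped ENNReal

noncomputable section

/-- The ratio `a / b` of nonnegative extended reals. A ratio with zero denominator is undefined; it
is given the value `∞`, so that it never counts as small. -/
def defRatio (a b : ℝ≥0∞) : ℝ≥0∞ := if b = 0 then ∞ else a / b

/-- `R N = o_P(1)` as `N → ∞`, for nonnegative (extended-real valued) functions `R N` on probability
spaces `(Ω N, μ N)` that may change with `N`. -/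
def IsLittleOP {Ω : ℕ → Type*} [∀ N, MeasurableSpace (Ω N)] (μ : ∀ N, Measure (Ω N))
    (R : ∀ N, Ω N → ℝ≥0∞) : Prop :=
  ∀ ε : ℝ, 0 < ε → Tendsto (fun N => μ N {z | ENNReal.ofReal ε ≤ R N z}) atTop (𝓝 0)

/-- A (symmetric) positive definite kernel: all its Gram matrices are positive semidefinite. -/
def IsPosDefKernel {𝒳 : Type*} (k : 𝒳 → 𝒳 → ℝ) : Prop :=
  ∀ (n : ℕ) (x : Fin n → 𝒳), (Matrix.of fun i j : Fin n => k (x i) (x j)).PosSemidef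

section Kernel

variable {𝒳 : Type*} [MeasurableSpace 𝒳]

/-- The kernel `k` centered with respect to `P`:
`k(x, y) - E[k(x, X₂)] - E[k(X₁, y)] + E[k(X₁, X₂)]` for `X₁, X₂` i.i.d. from `P`. -/
def centeredKernel (P : Measure 𝒳) (k : 𝒳 → 𝒳 → ℝ) (x y : 𝒳) : ℝ :=
  k x y - (∫ b, k x b ∂P) - (∫ a, k a y ∂P) + ∫ a, ∫ b, k a b ∂P ∂P

/-- The expected product `g(x, y) = E[k̄(x, X) k̄(y, X)]` of the centered kernel, with `X ∼ P`. -/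
def expectedProduct (P : Measure 𝒳) (k : 𝒳 → 𝒳 → ℝ) (x y : 𝒳) : ℝ :=
  ∫ a, centeredKernel P k x a * centeredKernel P k y a ∂P

/-- `E[k̄(X₁, X₂)⁴] + n E[k̄(X₁, X₂)² k̄(X₁, X₃)²]` divided by `n² (E[g(X, X)])²`,
for `X, X₁, X₂, X₃` i.i.d. from `P`. -/
def nullRatio (P : Measure 𝒳) (k : 𝒳 → 𝒳 → ℝ) (n : ℕ) : ℝ≥0∞ :=
  defRatio
    ((∫⁻ x₁, ∫⁻ x₂, ‖centeredKernel P k x₁ x₂‖ₑ ^ 4 ∂P ∂P) +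
      (n : ℝ≥0∞) * ∫⁻ x₁, ∫⁻ x₂, ∫⁻ x₃,
        ‖centeredKernel P k x₁ x₂‖ₑ ^ 2 * ‖centeredKernel P k x₁ x₃‖ₑ ^ 2 ∂P ∂P ∂P)
    ((n : ℝ≥0∞) ^ 2 * ENNReal.ofReal (∫ x, expectedProduct P k x x ∂P) ^ 2)

/-- `κ(x, y) = ∑ i, lam i * φ i x * φ i y` is a spectral decomposition of the kernel `κ` under `P`:
the `φ i` are orthonormal in `L²(P)`, they are eigenfunctions of the integral operator of `κ` with
eigenvalues `lam i`, and the series converges to `κ` in `L²(P ⊗ P)`. -/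
structure IsSpectralDecomposition {ι : Type*} (P : Measure 𝒳) (κ : 𝒳 → 𝒳 → ℝ)
    (lam : ι → ℝ) (φ : ι → 𝒳 → ℝ) : Prop where
  measurable : ∀ i, Measurable (φ i)
  memLp : ∀ i, MemLp (φ i) 2 P
  norm_one : ∀ i, ∫ x, φ i x ^ 2 ∂P = 1
  orthogonal : ∀ i j, i ≠ j → ∫ x, φ i x * φ j x ∂P = 0
  eigen : ∀ i, ∀ᵐ x ∂P, ∫ y, κ x y * φ i y ∂P = lam i * φ i x
  expansion : Tendsto
    (fun s : Finset ι =>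
      ∫⁻ p, ‖κ p.1 p.2 - ∑ i ∈ s, lam i * φ i p.1 * φ i p.2‖ₑ ^ 2 ∂(P.prod P)) atTop (𝓝 0)

/-- The estimated witness function `x ↦ n₁⁻¹ ∑ k(x̃ᵢ, x) - n₂⁻¹ ∑ k(ỹᵢ, x)`. -/
def witness (k : 𝒳 → 𝒳 → ℝ) {n₁ n₂ : ℕ} (z : (Fin n₁ → 𝒳) × (Fin n₂ → 𝒳)) (x : 𝒳) : ℝ :=
  (n₁ : ℝ)⁻¹ * ∑ i, k (z.1 i) x - (n₂ : ℝ)⁻¹ * ∑ i, k (z.2 i) x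

/-- The joint law of the two independent i.i.d. samples `X̃₁, …, X̃ₙ₁ ∼ P` and `Ỹ₁, …, Ỹₙ₂ ∼ Q`
from which the witness function is built. -/
def witnessLaw (P Q : Measure 𝒳) (n₁ n₂ : ℕ) : Measure ((Fin n₁ → 𝒳) × (Fin n₂ → 𝒳)) :=
  (Measure.pi fun _ : Fin n₁ => P).prod (Measure.pi fun _ : Fin n₂ => Q)

end Kernel

/-- The two folds of the labeled sample of size `n`. As `Fin n` counts from `0`, `Fold n true`
consists of the observations number 1, 3, 5, … and `Fold n false` of those number 2, 4, 6, … -/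
abbrev Fold (n : ℕ) (b : Bool) : Type := {j : Fin n // decide (Even (j : ℕ)) = b}

/-- A linear smoother trained on a sample `((X_j, V_j))_{j ∈ J}`: measurable weights
`w_j(v)`, which may depend on the training sample but not on the function of `X` to be regressed. -/
structure LinearSmoother (J 𝒳 𝒱 : Type*) [MeasurableSpace 𝒳] [MeasurableSpace 𝒱] where
  weight : (J → 𝒳 × 𝒱) → 𝒱 → J → ℝ
  measurable_weight : ∀ j, Measurable fun q : (J → 𝒳 × 𝒱) × 𝒱 => weight q.1 q.2 j

namespace LinearSmoother

variable {J 𝒳 𝒱 : Type*} [Fintype J] [MeasurableSpace 𝒳] [MeasurableSpace 𝒱]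

/-- The estimate `Ê[g(X) | V = v] = ∑ j, w_j(v) g(X_j)`. -/
def estimate (S : LinearSmoother J 𝒳 𝒱) (g : 𝒳 → ℝ) (D : J → 𝒳 × 𝒱) (v : 𝒱) : ℝ :=
  ∑ j, S.weight D v j * g (D j).1

/-- `Ê[a g(X) + b | V] = a Ê[g(X) | V] + b` almost surely, where `V` is a new covariate that is
independent of the training sample, which is i.i.d. from `P`. -/
def AffineEquivariant (S : LinearSmoother J 𝒳 𝒱) (P : Measure (𝒳 × 𝒱)) : Prop :=
  ∀ g : 𝒳 → ℝ, Measurable g → ∀ a b : ℝ,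
    ∀ᵐ q ∂((Measure.pi fun _ : J => P).prod P.snd),
      S.estimate (fun x => a * g x + b) q.1 q.2 = a * S.estimate g q.1 q.2 + b

/-- `E[(E[g(X) | V] - Ê[g(X) | V])²]` for a fixed function `g`, where the expectation is over the
training sample, i.i.d. from `P`, and over a new observation `(X, V) ∼ P` independent of it. -/
def condMSE (S : LinearSmoother J 𝒳 𝒱) (P : Measure (𝒳 × 𝒱)) (g : 𝒳 → ℝ) : ℝ≥0∞ :=
  ∫⁻ q, ‖(P[fun p : 𝒳 × 𝒱 => g p.1 | MeasurableSpace.comap Prod.snd inferInstance]) q.2 -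
      S.estimate g q.1 q.2.2‖ₑ ^ 2 ∂((Measure.pi fun _ : J => P).prod P)

/-- `E[(E[f(X) | V, f] - Ê[f(X) | V, f])² | f] / Var(f(X) | f)` at a realization `f` of a random
function that is independent of the training sample and of the new observation `(X, V) ∼ P`; by
this independence, conditioning on the random function is the same as holding it fixed. -/
def crossFitRatio (S : LinearSmoother J 𝒳 𝒱) (P : Measure (𝒳 × 𝒱)) (f : 𝒳 → ℝ) : ℝ≥0∞ :=
  defRatio (S.condMSE P f) (ENNReal.ofReal (variance f P.fst))

end LinearSmoother

end

/-!
Under the null hypothesis, affine equivariance lets the witness be replaced by its centered version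
`x ↦ ∑ j, a j * k̄(Z j, x)`, where `Z` is the pooled i.i.d. sample and the weights `a j` are
`1 / n₁` and `-1 / n₂`.

Expanding in eigenfunctions, the mean over `Z` of the numerator is at most `A * σ` times the largest
risk of the smoother on an eigenfunction, with `A = ∑ j, a j ^ 2` and `σ = E[k̄(X₁, X₂) ^ 2]`, and
Markov's inequality applies.

The denominator, whose mean is `A * σ`, must not be small. It is the squared `L²` norm of the sum
of the independent centered features `a j • k̄(Z j, ·)`. Integrating the characteristic function of
the sum against a Gaussian vector turns the Laplace transform of the squared norm into a product of
characteristic functions of real variables; comparing with a Gaussian bounds the probability that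
the squared norm is below `A * σ / u` by a constant times `1 / √(1 + u)` plus `u ^ 2` times the
moment ratio. Letting first `N → ∞` and then `u → ∞` gives the claim.
-/

theorem cos_le_one_sub_sq_div_two_add (y : ℝ) : Real.cos y ≤ 1 - y ^ 2 / 2 + y ^ 4 / 2 := by
  rcases le_total |y| 1 with hy | hy
  · have := (abs_le.1 (Real.cos_bound hy)).2
    rw [Even.pow_abs (by decide)] at this
    nlinarith [pow_nonneg (sq_nonneg y) 2]
  · have : 1 ≤ y ^ 2 := (one_le_sq_iff_one_le_abs y).2 hy
    nlinarith [Real.cos_le_one y]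

theorem cos_sub_le (u v : ℝ) :
    Real.cos (u - v) ≤ 1 - (u ^ 2 + v ^ 2) / 2 + u * v + 4 * (u ^ 4 + v ^ 4) := by
  have h4 : (u + -v) ^ 4 ≤ 2 ^ 3 * (u ^ 4 + (-v) ^ 4) := Even.add_pow_le (by decide)
  rw [← sub_eq_add_neg, Even.neg_pow (by decide)] at h4
  linarith [cos_le_one_sub_sq_div_two_add (u - v), sub_sq u v]

theorem integral_cos_sub_le {α : Type*} [MeasurableSpace α] {P : Measure α}
    [IsProbabilityMeasure P] {X : α → ℝ} (hX : MemLp X 4 P) (hcent : ∫ x, X x ∂P = 0) :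
    ∫ p, Real.cos (X p.1 - X p.2) ∂P.prod P ≤ 1 - ∫ x, X x ^ 2 ∂P + 8 * ∫ x, X x ^ 4 ∂P := by
  have h1 : Integrable X P := hX.integrable (by norm_num)
  have h2 : Integrable (fun x => X x ^ 2) P := (hX.mono_exponent (by norm_num)).integrable_sq
  have h4 : Integrable (fun x => X x ^ 4) P :=
    (hX.integrable_norm_pow (by norm_num)).congr
      (ae_of_all _ fun x => by simp only [Real.norm_eq_abs]; exact Even.pow_abs (by decide) _)
  have hquad : Integrable (fun p : α × α => (X p.1 ^ 2 + X p.2 ^ 2) / 2) (P.prod P) :=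
    ((h2.comp_fst P).add (h2.comp_snd P)).div_const 2
  have hquart : Integrable (fun p : α × α => 4 * (X p.1 ^ 4 + X p.2 ^ 4)) (P.prod P) :=
    ((h4.comp_fst P).add (h4.comp_snd P)).const_mul 4
  have hsub : Integrable (fun p : α × α => 1 - (X p.1 ^ 2 + X p.2 ^ 2) / 2) (P.prod P) :=
    (integrable_const 1).sub hquad
  have hadd : Integrable (fun p : α × α => 1 - (X p.1 ^ 2 + X p.2 ^ 2) / 2 + X p.1 * X p.2)
    (P.prod P) := hsub.add (h1.mul_prod h1)
  have hcos : Integrable (fun p : α × α => Real.cos (X p.1 - X p.2)) (P.prod P) :=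
    .of_bound (Real.continuous_cos.comp_aestronglyMeasurable
      (hX.1.comp_fst.sub hX.1.comp_snd)) 1 (ae_of_all _ fun p => Real.abs_cos_le_one _)
  calc ∫ p, Real.cos (X p.1 - X p.2) ∂P.prod P
      ≤ ∫ p, (1 - (X p.1 ^ 2 + X p.2 ^ 2) / 2 + X p.1 * X p.2 + 4 * (X p.1 ^ 4 + X p.2 ^ 4))
          ∂P.prod P := integral_mono hcos (hadd.add hquart) fun p => cos_sub_le _ _
    _ = 1 - ∫ x, X x ^ 2 ∂P + 8 * ∫ x, X x ^ 4 ∂P := by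
        rw [integral_add hadd hquart, integral_add hsub (h1.mul_prod h1),
          integral_sub (integrable_const _) hquad, integral_div, integral_const_mul,
          integral_add (h2.comp_fst P) (h2.comp_snd P), integral_prod_mul, hcent,
          integral_add (h4.comp_fst P) (h4.comp_snd P),
          integral_fun_fst fun x => X x ^ 2, integral_fun_snd fun x => X x ^ 2,
          integral_fun_fst fun x => X x ^ 4, integral_fun_snd fun x => X x ^ 4]
        simp only [integral_const, probReal_univ, smul_eq_mul]
        ring

section CharFun

variable {E : Type*} [NormedAddCommGroup E] [InnerProductSpace ℝ E] [MeasurableSpace E]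
  [OpensMeasurableSpace E] {μ : Measure E} [IsProbabilityMeasure μ] {ξ : E}

theorem sq_norm_charFun_eq_integral_cos (μ : Measure E)
    [IsProbabilityMeasure μ] (ξ : E) :
    ‖charFun μ ξ‖ ^ 2 = ∫ p, Real.cos (inner ℝ p.1 ξ - inner ℝ p.2 ξ) ∂μ.prod μ := by
  have hm : Measurable fun x : E => inner ℝ x ξ := Continuous.measurable (by fun_prop)
  have hexp : ∀ p : E × E, Complex.exp (inner ℝ p.1 ξ * Complex.I) *
      Complex.exp (inner ℝ p.2 (-ξ) * Complex.I) =
        Complex.exp (↑(inner ℝ p.1 ξ - inner ℝ p.2 ξ) * Complex.I) := fun p => by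
    rw [← Complex.exp_add, inner_neg_right]
    congr 1
    push_cast
    ring
  have hint : Integrable (fun p : E × E =>
      Complex.exp (↑(inner ℝ p.1 ξ - inner ℝ p.2 ξ) * Complex.I)) (μ.prod μ) :=
    .of_bound (Measurable.aestronglyMeasurable (by fun_prop)) 1
      (ae_of_all _ fun p => (Complex.norm_exp_ofReal_mul_I _).le)
  have hmul : (↑(‖charFun μ ξ‖ ^ 2) : ℂ) =
      ∫ p, Complex.exp (↑(inner ℝ p.1 ξ - inner ℝ p.2 ξ) * Complex.I) ∂μ.prod μ := by
    rw [Complex.ofReal_pow, ← Complex.mul_conj', ← charFun_neg, charFun_apply, charFun_apply,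
      ← integral_prod_mul]
    exact integral_congr_ae (ae_of_all _ hexp)
  rw [← Complex.ofReal_re (‖charFun μ ξ‖ ^ 2), hmul, ← RCLike.re_eq_complex_re, ← integral_re hint]
  simp only [RCLike.re_eq_complex_re, Complex.exp_ofReal_mul_I_re]

theorem sq_norm_charFun_le_exp (hcent : ∫ x, inner ℝ x ξ ∂μ = 0)
    (hL4 : MemLp (fun x => inner ℝ x ξ) 4 μ) :
    ‖charFun μ ξ‖ ^ 2 ≤
      Real.exp (-∫ x, inner ℝ x ξ ^ 2 ∂μ + 8 * ∫ x, inner ℝ x ξ ^ 4 ∂μ) := by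
  rw [sq_norm_charFun_eq_integral_cos]
  linarith [integral_cos_sub_le hL4 hcent,
    Real.add_one_le_exp (-∫ x, inner ℝ x ξ ^ 2 ∂μ + 8 * ∫ x, inner ℝ x ξ ^ 4 ∂μ)]

theorem prod_norm_charFun_smul_le {J : Type*} [Fintype J] (a : J → ℝ)
    (hcent : ∫ x, inner ℝ x ξ ∂μ = 0) (hL4 : MemLp (fun x => inner ℝ x ξ) 4 μ) :
    ∏ j, ‖charFun μ (a j • ξ)‖ ≤
      Real.exp 1 * Real.exp (-((∑ j, a j ^ 2) / 2 * ∫ x, inner ℝ x ξ ^ 2 ∂μ)) +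
        4 * (∑ j, a j ^ 4) * ∫ x, inner ℝ x ξ ^ 4 ∂μ := by
  set m₂ := ∫ x, inner ℝ x ξ ^ 2 ∂μ
  set m₄ := ∫ x, inner ℝ x ξ ^ 4 ∂μ
  have hfactor (j : J) :
      ‖charFun μ (a j • ξ)‖ ≤ Real.exp (-(a j ^ 2 / 2 * m₂) + 4 * a j ^ 4 * m₄) := by
    have h := sq_norm_charFun_le_exp (μ := μ) (ξ := a j • ξ)
      (by simp [inner_smul_right, integral_const_mul, hcent])
      (by simpa only [inner_smul_right] using hL4.const_mul (a j))
    simp_rw [inner_smul_right, mul_pow, integral_const_mul] at h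
    refine (pow_le_pow_iff_left₀ (norm_nonneg _) (Real.exp_pos _).le two_ne_zero).1
      (h.trans_eq ?_)
    rw [← Real.exp_nat_mul]
    congr 1
    push_cast
    ring
  have hm₄ : 0 ≤ (∑ j, a j ^ 4) * m₄ := by positivity
  rcases le_total 1 (4 * (∑ j, a j ^ 4) * m₄) with hlarge | hsmall
  · have hprod : ∏ j, ‖charFun μ (a j • ξ)‖ ≤ 1 :=
      Finset.prod_le_one (fun j _ => norm_nonneg _) fun j _ => norm_charFun_le_one _
    have : 0 ≤ Real.exp 1 * Real.exp (-((∑ j, a j ^ 2) / 2 * m₂)) := by positivity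
    linarith
  · calc ∏ j, ‖charFun μ (a j • ξ)‖
        ≤ ∏ j, Real.exp (-(a j ^ 2 / 2 * m₂) + 4 * a j ^ 4 * m₄) :=
          Finset.prod_le_prod (fun j _ => norm_nonneg _) fun j _ => hfactor j
      _ = Real.exp (4 * (∑ j, a j ^ 4) * m₄) * Real.exp (-((∑ j, a j ^ 2) / 2 * m₂)) := by
          rw [← Real.exp_sum, ← Real.exp_add, Finset.sum_add_distrib, Finset.sum_neg_distrib,
            ← Finset.sum_mul, ← Finset.sum_mul, ← Finset.mul_sum, ← Finset.sum_div, add_comm]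
      _ ≤ Real.exp 1 * Real.exp (-((∑ j, a j ^ 2) / 2 * m₂)) := by gcongr
      _ ≤ _ := by linarith

end CharFun

theorem norm_exp_neg_le_one {v : ℝ} (hv : 0 ≤ v) : ‖Real.exp (-v)‖ ≤ 1 := by
  rw [Real.norm_eq_abs, Real.abs_exp]
  exact Real.exp_le_one_iff.2 (neg_nonpos.2 hv)

section Gaussian

theorem integral_exp_neg_mul_sq_gaussianReal {c : ℝ} (hc : 0 ≤ c) :
    ∫ x, Real.exp (-(c * x ^ 2)) ∂(gaussianReal 0 1) = (√(1 + 2 * c))⁻¹ := by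
  have hexp : ∀ x : ℝ, (√(2 * Real.pi))⁻¹ * Real.exp (-x ^ 2 / 2) * Real.exp (-(c * x ^ 2))
      = (√(2 * Real.pi))⁻¹ * Real.exp (-(1 / 2 + c) * x ^ 2) := fun x => by
    rw [mul_assoc, ← Real.exp_add]
    ring_nf
  rw [integral_gaussianReal_eq_integral_smul one_ne_zero]
  simp only [gaussianPDFReal, smul_eq_mul, NNReal.coe_one, mul_one, sub_zero]
  simp_rw [hexp]
  rw [integral_const_mul, integral_gaussian, ← Real.sqrt_inv, ← Real.sqrt_inv,
    ← Real.sqrt_mul (by positivity)]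
  congr 1
  have := Real.pi_pos
  field_simp

variable {E : Type*} [NormedAddCommGroup E] [InnerProductSpace ℝ E] [FiniteDimensional ℝ E]
  [MeasurableSpace E] [BorelSpace E]

theorem map_inner_stdGaussian (x : E) :
    (stdGaussian E).map (fun ξ => inner ℝ x ξ) = (gaussianReal 0 1).map fun u => ‖x‖ * u := by
  have h := IsGaussian.map_eq_gaussianReal (μ := stdGaussian E) (innerSL ℝ x)
  rw [integral_strongDual_stdGaussian, variance_dual_stdGaussian, innerSL_apply_norm] at h
  rw [gaussianReal_map_const_mul, mul_zero, mul_one]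
  rwa [Real.toNNReal_of_nonneg (sq_nonneg _)] at h

theorem integral_comp_inner_stdGaussian (x : E) {f : ℝ → ℝ} (hf : Measurable f) :
    ∫ ξ, f (inner ℝ x ξ) ∂stdGaussian E = ∫ u, f (‖x‖ * u) ∂gaussianReal 0 1 := by
  rw [← integral_map (φ := fun ξ : E => inner ℝ x ξ) (by fun_prop) hf.aestronglyMeasurable,
    map_inner_stdGaussian, integral_map (by fun_prop) hf.aestronglyMeasurable]

theorem integral_charFun_stdGaussian (μ : Measure E) [IsFiniteMeasure μ] :
    ∫ ξ, charFun μ ξ ∂stdGaussian E = ∫ x, (Real.exp (-(‖x‖ ^ 2 / 2)) : ℂ) ∂μ := by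
  have hint : Integrable (Function.uncurry fun ξ x : E => Complex.exp (inner ℝ x ξ * Complex.I))
      ((stdGaussian E).prod μ) :=
    .of_bound (Continuous.aestronglyMeasurable (by fun_prop)) 1
      (ae_of_all _ fun p => (Complex.norm_exp_ofReal_mul_I _).le)
  simp_rw [charFun_apply]
  rw [integral_integral_swap hint]
  refine integral_congr_ae (ae_of_all _ fun x => ?_)
  have h := charFun_stdGaussian x
  rw [charFun_apply] at h
  simp_rw [real_inner_comm _ x]
  rw [h]
  push_cast
  ring_nf

theorem charFun_map_sum_smul {J : Type*} [Fintype J] (μ : Measure E) [IsProbabilityMeasure μ]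
    (a : J → ℝ) (ξ : E) :
    charFun ((Measure.pi fun _ : J => μ).map fun x => ∑ j, a j • x j) ξ =
      ∏ j, charFun μ (a j • ξ) := by
  have hindep : iIndepFun (fun j (x : J → E) => a j • x j) (Measure.pi fun _ : J => μ) :=
    iIndepFun_pi (X := fun j (x : E) => a j • x) fun j => by fun_prop
  rw [hindep.charFun_map_fun_sum_eq_prod fun j => Measurable.aemeasurable (by fun_prop),
    Finset.prod_apply]
  refine Finset.prod_congr rfl fun j _ => ?_
  have hcomp : (fun x : J → E => a j • x j) = (fun y => a j • y) ∘ Function.eval j := rfl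
  rw [hcomp, ← Measure.map_map (by fun_prop) (by fun_prop),
    (measurePreserving_eval (fun _ : J => μ) j).map_eq, charFun_map_smul]

theorem exp_neg_integral_mul_le {α : Type*} [MeasurableSpace α] {P : Measure α} {w y : α → ℝ}
    (hw : ∀ x, 0 ≤ w x) (hwI : Integrable w P) (hw1 : ∫ x, w x ∂P = 1)
    (hwy : Integrable (fun x => w x * y x) P)
    (hwexp : Integrable (fun x => w x * Real.exp (-y x)) P) :
    Real.exp (-∫ x, w x * y x ∂P) ≤ ∫ x, w x * Real.exp (-y x) ∂P := by
  set m := ∫ x, w x * y x ∂P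
  have htangent : ∀ x, Real.exp (-m) * ((1 + m) * w x - w x * y x) ≤ w x * Real.exp (-y x) := by
    intro x
    have h := mul_le_mul_of_nonneg_left (Real.add_one_le_exp (m - y x)) (Real.exp_pos (-m)).le
    rw [← Real.exp_add] at h
    calc _ = w x * (Real.exp (-m) * (m - y x + 1)) := by ring
      _ ≤ w x * Real.exp (-m + (m - y x)) := by gcongr; exact hw x
      _ = w x * Real.exp (-y x) := by ring_nf
  calc Real.exp (-m) = ∫ x, Real.exp (-m) * ((1 + m) * w x - w x * y x) ∂P := by
        rw [integral_const_mul, integral_sub (hwI.const_mul _) hwy, integral_const_mul, hw1]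
        ring
    _ ≤ _ := integral_mono (((hwI.const_mul _).sub hwy).const_mul _) hwexp htangent

/-- Jensen's inequality with the weights `‖x‖ ^ 2 / ∫ ‖x‖ ^ 2` reduces the quadratic form of `μ` to
its unit directions, for which the Gaussian integral over `ξ` is one-dimensional. -/
theorem exp_neg_integral_inner_sq_le {μ : Measure E} [IsFiniteMeasure μ] (hμ : MemLp id 2 μ)
    (hT : 0 < ∫ x, ‖x‖ ^ 2 ∂μ) {c : ℝ} (hc : 0 ≤ c) (ξ : E) :
    Real.exp (-(c * ∫ x, inner ℝ x ξ ^ 2 ∂μ)) ≤ ∫ x, ‖x‖ ^ 2 / (∫ x, ‖x‖ ^ 2 ∂μ) *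
      Real.exp (-(c * (∫ x, ‖x‖ ^ 2 ∂μ) * inner ℝ (‖x‖⁻¹ • x) ξ ^ 2)) ∂μ := by
  set T := ∫ x, ‖x‖ ^ 2 ∂μ
  have hsq : Integrable (fun x : E => ‖x‖ ^ 2) μ := hμ.integrable_norm_pow (by norm_num)
  have hinner : Integrable (fun x => inner ℝ x ξ ^ 2) μ := (hμ.inner_const ξ).integrable_sq
  have hdir : ∀ x : E, ‖x‖ ^ 2 / T * (c * T * inner ℝ (‖x‖⁻¹ • x) ξ ^ 2) =
      c * inner ℝ x ξ ^ 2 := fun x => by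
    rcases eq_or_ne x 0 with rfl | hx
    · simp
    · rw [real_inner_smul_left]
      have : ‖x‖ ≠ 0 := norm_ne_zero_iff.2 hx
      field_simp
  have h := exp_neg_integral_mul_le (P := μ) (w := fun x => ‖x‖ ^ 2 / T)
    (y := fun x => c * T * inner ℝ (‖x‖⁻¹ • x) ξ ^ 2) (fun x => by positivity) (hsq.div_const T)
    (by rw [integral_div, div_self hT.ne']) (by simpa only [hdir] using hinner.const_mul c)
    ((hsq.div_const T).mul_bdd (Measurable.aestronglyMeasurable (by fun_prop))
      (ae_of_all _ fun x => norm_exp_neg_le_one (by positivity)))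
  simpa only [hdir, integral_const_mul] using h

theorem integral_exp_neg_integral_inner_sq_stdGaussian_le {μ : Measure E} [IsFiniteMeasure μ]
    (hμ : MemLp id 2 μ) {c : ℝ} (hc : 0 ≤ c) :
    ∫ ξ, Real.exp (-(c * ∫ x, inner ℝ x ξ ^ 2 ∂μ)) ∂stdGaussian E ≤
      (√(1 + 2 * (c * ∫ x, ‖x‖ ^ 2 ∂μ)))⁻¹ := by
  set T := ∫ x, ‖x‖ ^ 2 ∂μ with hTdef
  rcases (show 0 ≤ T by positivity).eq_or_lt with hT | hT
  · rw [← hT, mul_zero, mul_zero, add_zero, Real.sqrt_one, inv_one]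
    calc ∫ ξ, Real.exp (-(c * ∫ x, inner ℝ x ξ ^ 2 ∂μ)) ∂stdGaussian E
        ≤ ∫ _, 1 ∂stdGaussian E :=
          integral_mono_of_nonneg (ae_of_all _ fun ξ => (Real.exp_pos _).le) (integrable_const 1)
            (ae_of_all _ fun ξ => Real.exp_le_one_iff.2 (neg_nonpos.2 (by positivity)))
      _ = 1 := by simp
  have hsq : Integrable (fun x : E => ‖x‖ ^ 2) μ := hμ.integrable_norm_pow (by norm_num)
  have hint : Integrable (Function.uncurry fun ξ x : E =>
      ‖x‖ ^ 2 / T * Real.exp (-(c * T * inner ℝ (‖x‖⁻¹ • x) ξ ^ 2))) ((stdGaussian E).prod μ) :=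
    ((hsq.div_const T).comp_snd _).mul_bdd (Measurable.aestronglyMeasurable (by fun_prop))
      (ae_of_all _ fun p => norm_exp_neg_le_one (by positivity))
  calc ∫ ξ, Real.exp (-(c * ∫ x, inner ℝ x ξ ^ 2 ∂μ)) ∂stdGaussian E
      ≤ ∫ ξ, ∫ x, ‖x‖ ^ 2 / T * Real.exp (-(c * T * inner ℝ (‖x‖⁻¹ • x) ξ ^ 2)) ∂μ
          ∂stdGaussian E :=
        integral_mono_of_nonneg (ae_of_all _ fun ξ => (Real.exp_pos _).le)
          hint.integral_prod_left (ae_of_all _ fun ξ => exp_neg_integral_inner_sq_le hμ hT hc ξ)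
    _ = ∫ x, ‖x‖ ^ 2 / T * (√(1 + 2 * (c * T)))⁻¹ ∂μ := by
        rw [integral_integral_swap hint]
        refine integral_congr_ae (ae_of_all _ fun x => ?_)
        rcases eq_or_ne x 0 with rfl | hx
        · simp
        have hunit : ‖‖x‖⁻¹ • x‖ = 1 := norm_smul_inv_norm (𝕜 := ℝ) hx
        simp only [integral_const_mul]
        rw [integral_comp_inner_stdGaussian (‖x‖⁻¹ • x)
            (f := fun u => Real.exp (-(c * T * u ^ 2))) (by fun_prop), hunit]
        simp only [one_mul, integral_exp_neg_mul_sq_gaussianReal (mul_nonneg hc hT.le)]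
    _ = (√(1 + 2 * (c * T)))⁻¹ := by
        rw [integral_mul_const, integral_div, ← hTdef, div_self hT.ne', one_mul]

/-- The fourth moment of the standard normal distribution, the only feature of it that enters the
error term of the small-ball inequality. -/
noncomputable def gaussianFourthMoment : ℝ := ∫ u, u ^ 4 ∂gaussianReal 0 1

theorem integrable_inner_pow_four_prod {μ : Measure E} [IsFiniteMeasure μ] (hL4 : MemLp id 4 μ) :
    Integrable (Function.uncurry fun ξ x : E => inner ℝ x ξ ^ 4) ((stdGaussian E).prod μ) := by
  have hξ : Integrable (fun ξ : E => ‖ξ‖ ^ 4) (stdGaussian E) :=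
    (IsGaussian.memLp_id (stdGaussian E) 4 (by simp)).integrable_norm_pow (by norm_num)
  have hx : Integrable (fun x : E => ‖x‖ ^ 4) μ := hL4.integrable_norm_pow (by norm_num)
  refine (hξ.mul_prod hx).mono' (Continuous.aestronglyMeasurable (by fun_prop))
    (ae_of_all _ fun p => ?_)
  rw [Function.uncurry, norm_pow, ← mul_pow, mul_comm]
  gcongr
  exact norm_inner_le_norm _ _

theorem integral_integral_inner_pow_four {μ : Measure E} [IsFiniteMeasure μ] (hL4 : MemLp id 4 μ) :
    ∫ ξ, ∫ x, inner ℝ x ξ ^ 4 ∂μ ∂stdGaussian E = gaussianFourthMoment * ∫ x, ‖x‖ ^ 4 ∂μ := by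
  rw [integral_integral_swap (integrable_inner_pow_four_prod hL4), ← integral_const_mul]
  refine integral_congr_ae (ae_of_all _ fun x => ?_)
  simp only [integral_comp_inner_stdGaussian x (f := fun u => u ^ 4) (by fun_prop), mul_pow]
  rw [integral_const_mul, gaussianFourthMoment, mul_comm]

section SmallBall

variable {J : Type*} [Fintype J] {μ : Measure E} [IsProbabilityMeasure μ]

theorem integral_exp_neg_sq_norm_sum_smul_le_integral_prod (μ : Measure E) [IsProbabilityMeasure μ]
    (a : J → ℝ) :
    ∫ x, Real.exp (-(‖∑ j, a j • x j‖ ^ 2 / 2)) ∂(Measure.pi fun _ : J => μ) ≤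
      ∫ ξ, ∏ j, ‖charFun μ (a j • ξ)‖ ∂stdGaussian E := by
  have hlaw := integral_charFun_stdGaussian
    ((Measure.pi fun _ : J => μ).map fun x => ∑ j, a j • x j)
  rw [integral_map (Measurable.aemeasurable (by fun_prop))
    (Continuous.aestronglyMeasurable (by fun_prop)), integral_complex_ofReal] at hlaw
  calc _ ≤ ‖((∫ x, Real.exp (-(‖∑ j, a j • x j‖ ^ 2 / 2)) ∂(Measure.pi fun _ : J => μ) : ℝ) :
          ℂ)‖ := by
        rw [Complex.norm_real]
        exact Real.le_norm_self _
    _ ≤ _ := by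
        rw [← hlaw]
        refine (norm_integral_le_integral_norm _).trans_eq ?_
        simp_rw [charFun_map_sum_smul, norm_prod]

theorem integral_exp_neg_sq_norm_sum_smul_le (hcent : ∫ x, x ∂μ = 0) (hL4 : MemLp id 4 μ)
    (a : J → ℝ) :
    ∫ x, Real.exp (-(‖∑ j, a j • x j‖ ^ 2 / 2)) ∂(Measure.pi fun _ : J => μ) ≤
      Real.exp 1 * (√(1 + (∑ j, a j ^ 2) * ∫ x, ‖x‖ ^ 2 ∂μ))⁻¹ +
        4 * gaussianFourthMoment * (∑ j, a j ^ 4) * ∫ x, ‖x‖ ^ 4 ∂μ := by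
  have hL2 : MemLp id 2 μ := hL4.mono_exponent (by norm_num)
  have hA : 0 ≤ (∑ j, a j ^ 2) / 2 := by positivity
  have hI4 : Integrable (fun ξ => ∫ x, inner ℝ x ξ ^ 4 ∂μ) (stdGaussian E) :=
    (integrable_inner_pow_four_prod hL4).integral_prod_left
  have hIexp : Integrable (fun ξ => Real.exp (-((∑ j, a j ^ 2) / 2 * ∫ x, inner ℝ x ξ ^ 2 ∂μ)))
      (stdGaussian E) := by
    have hm : Measurable fun ξ : E => ∫ x, inner ℝ x ξ ^ 2 ∂μ :=
      (StronglyMeasurable.integral_prod_right (f := fun ξ x : E => inner ℝ x ξ ^ 2)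
        (Continuous.stronglyMeasurable (by fun_prop))).measurable
    exact .of_bound (Measurable.aestronglyMeasurable (by fun_prop)) 1
      (ae_of_all _ fun ξ => norm_exp_neg_le_one (by positivity))
  have hpoint : ∀ ξ, ∏ j, ‖charFun μ (a j • ξ)‖ ≤
      Real.exp 1 * Real.exp (-((∑ j, a j ^ 2) / 2 * ∫ x, inner ℝ x ξ ^ 2 ∂μ)) +
        4 * (∑ j, a j ^ 4) * ∫ x, inner ℝ x ξ ^ 4 ∂μ := fun ξ =>
    prod_norm_charFun_smul_le a
      (by simpa [hcent, real_inner_comm] using integral_inner (hL4.integrable (by norm_num)) ξ)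
      (hL4.inner_const ξ)
  calc _ ≤ _ := integral_exp_neg_sq_norm_sum_smul_le_integral_prod μ a
    _ ≤ _ := integral_mono_of_nonneg (ae_of_all _ fun ξ => by positivity)
      ((hIexp.const_mul _).add (hI4.const_mul _)) (ae_of_all _ hpoint)
    _ ≤ _ := by
      rw [integral_add' (hIexp.const_mul _) (hI4.const_mul _), integral_const_mul,
        integral_const_mul, integral_integral_inner_pow_four hL4]
      refine add_le_add (mul_le_mul_of_nonneg_left
        ((integral_exp_neg_integral_inner_sq_stdGaussian_le hL2 hA).trans_eq ?_)
        (Real.exp_pos 1).le) (le_of_eq ?_)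
      · congr 3
        ring
      · ring

/-- The absolute constant of the small-ball inequality for sums of independent random vectors. The
factor `exp (1 / 2)` comes from Markov's inequality for `exp (-‖·‖ ^ 2 / (2 * r))` at
radius `√r`. -/
noncomputable def smallBallConst : ℝ :=
  Real.exp (1 / 2) * max (Real.exp 1) (4 * gaussianFourthMoment)

theorem smallBallConst_nonneg : 0 ≤ smallBallConst :=
  mul_nonneg (Real.exp_pos _).le (le_max_of_le_left (Real.exp_pos _).le)

theorem integral_exp_neg_sq_norm_sum_smul_div_le (hcent : ∫ x, x ∂μ = 0) (hL4 : MemLp id 4 μ)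
    (a : J → ℝ) {r : ℝ} (hr : 0 < r) :
    ∫ x, Real.exp (-(‖∑ j, a j • x j‖ ^ 2 / r / 2)) ∂(Measure.pi fun _ : J => μ) ≤
      Real.exp 1 * (√(1 + (∑ j, a j ^ 2) * (∫ x, ‖x‖ ^ 2 ∂μ) / r))⁻¹ +
        4 * gaussianFourthMoment * ((∑ j, a j ^ 4) / r ^ 2) * ∫ x, ‖x‖ ^ 4 ∂μ := by
  have hscale : ∀ x : J → E, ‖∑ j, (a j / √r) • x j‖ ^ 2 = ‖∑ j, a j • x j‖ ^ 2 / r := fun x => by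
    simp_rw [div_eq_inv_mul, mul_smul, ← Finset.smul_sum]
    rw [norm_smul, mul_pow, Real.norm_eq_abs, sq_abs, inv_pow, Real.sq_sqrt hr.le]
  have hsq : ∑ j, (a j / √r) ^ 2 = (∑ j, a j ^ 2) / r := by
    simp_rw [div_pow, Real.sq_sqrt hr.le, Finset.sum_div]
  have hquart : ∑ j, (a j / √r) ^ 4 = (∑ j, a j ^ 4) / r ^ 2 := by
    rw [Finset.sum_div]
    refine Finset.sum_congr rfl fun j _ => ?_
    rw [div_pow, show √r ^ 4 = (√r ^ 2) ^ 2 by ring, Real.sq_sqrt hr.le]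
  have h := integral_exp_neg_sq_norm_sum_smul_le hcent hL4 fun j => a j / √r
  simp_rw [hscale, hsq, hquart] at h
  rwa [div_mul_eq_mul_div] at h

theorem measureReal_sq_norm_sum_smul_le (hcent : ∫ x, x ∂μ = 0) (hL4 : MemLp id 4 μ)
    (a : J → ℝ) {r : ℝ} (hr : 0 < r) :
    (Measure.pi fun _ : J => μ).real {x | ‖∑ j, a j • x j‖ ^ 2 ≤ r} ≤
      smallBallConst * ((√(1 + (∑ j, a j ^ 2) * (∫ x, ‖x‖ ^ 2 ∂μ) / r))⁻¹ +
        (∑ j, a j ^ 4) / r ^ 2 * ∫ x, ‖x‖ ^ 4 ∂μ) := by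
  set D := (√(1 + (∑ j, a j ^ 2) * (∫ x, ‖x‖ ^ 2 ∂μ) / r))⁻¹
  have hmarkov := mul_meas_ge_le_integral_of_nonneg (μ := Measure.pi fun _ : J => μ)
    (f := fun x => Real.exp (-(‖∑ j, a j • x j‖ ^ 2 / r / 2)))
    (ae_of_all _ fun x => (Real.exp_pos _).le)
    (.of_bound (Measurable.aestronglyMeasurable (by fun_prop)) 1
      (ae_of_all _ fun x => norm_exp_neg_le_one (by positivity))) (Real.exp (-(1 / 2)))
  have hsub : {x : J → E | ‖∑ j, a j • x j‖ ^ 2 ≤ r} ⊆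
      {x | Real.exp (-(1 / 2)) ≤ Real.exp (-(‖∑ j, a j • x j‖ ^ 2 / r / 2))} := fun x hx =>
    Real.exp_le_exp.2 (by linarith [(div_le_one hr).2 hx])
  calc (Measure.pi fun _ : J => μ).real {x | ‖∑ j, a j • x j‖ ^ 2 ≤ r}
      = Real.exp (1 / 2) * (Real.exp (-(1 / 2)) *
          (Measure.pi fun _ : J => μ).real {x | ‖∑ j, a j • x j‖ ^ 2 ≤ r}) := by
        rw [← mul_assoc, ← Real.exp_add]
        simp
    _ ≤ Real.exp (1 / 2) * (Real.exp 1 * D +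
          4 * gaussianFourthMoment * ((∑ j, a j ^ 4) / r ^ 2) * ∫ x, ‖x‖ ^ 4 ∂μ) := by
        gcongr
        exact (mul_le_mul_of_nonneg_left (measureReal_mono hsub) (Real.exp_pos _).le).trans
          (hmarkov.trans (integral_exp_neg_sq_norm_sum_smul_div_le hcent hL4 a hr))
    _ ≤ Real.exp (1 / 2) * (max (Real.exp 1) (4 * gaussianFourthMoment) * D +
          max (Real.exp 1) (4 * gaussianFourthMoment) * ((∑ j, a j ^ 4) / r ^ 2) *
            ∫ x, ‖x‖ ^ 4 ∂μ) := by
        gcongr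
        · exact le_max_left _ _
        · exact le_max_right _ _
    _ = smallBallConst * (D + (∑ j, a j ^ 4) / r ^ 2 * ∫ x, ‖x‖ ^ 4 ∂μ) := by
        rw [smallBallConst]
        ring

end SmallBall

end Gaussian

section L2

variable {α ι : Type*} [MeasurableSpace α] {P : Measure α}

theorem inner_toLp_toLp {f g : α → ℝ} (hf : MemLp f 2 P) (hg : MemLp g 2 P) :
    inner ℝ (hf.toLp f) (hg.toLp g) = ∫ x, f x * g x ∂P := by
  rw [L2.inner_def]
  refine integral_congr_ae ?_
  filter_upwards [hf.coeFn_toLp, hg.coeFn_toLp] with x hfx hgx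
  rw [hfx, hgx, real_inner_comm]
  rfl

theorem sq_norm_toLp {f : α → ℝ} (hf : MemLp f 2 P) : ‖hf.toLp f‖ ^ 2 = ∫ x, f x ^ 2 ∂P := by
  rw [← real_inner_self_eq_norm_sq, inner_toLp_toLp]
  simp only [sq]

theorem toLp_sum_mul {φ : ι → α → ℝ} (hφ : ∀ i, MemLp (φ i) 2 P) (s : Finset ι) (c : ι → ℝ) :
    (memLp_finsetSum s fun i _ => (hφ i).const_mul (c i)).toLp (fun x => ∑ i ∈ s, c i * φ i x)
      = ∑ i ∈ s, c i • (hφ i).toLp (φ i) := by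
  refine Lp.ext ((MemLp.coeFn_toLp _).trans ?_)
  have hsmul : ∀ᵐ x ∂P, ∀ i ∈ s, (c i • (hφ i).toLp (φ i) : Lp ℝ 2 P) x = c i * φ i x :=
    (Finset.eventually_all s).2 fun i _ => by
      filter_upwards [Lp.coeFn_smul (c i) ((hφ i).toLp (φ i)), (hφ i).coeFn_toLp] with x h1 h2
      rw [h1, Pi.smul_apply, h2, smul_eq_mul]
  filter_upwards [Lp.coeFn_finsetSum s fun i => c i • (hφ i).toLp (φ i), hsmul] with x h1 h2
  rw [h1, Finset.sum_apply]
  exact (Finset.sum_congr rfl h2).symm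

theorem orthonormal_toLp {φ : ι → α → ℝ} (hφ : ∀ i, MemLp (φ i) 2 P)
    (hone : ∀ i, ∫ x, φ i x ^ 2 ∂P = 1) (horth : ∀ i j, i ≠ j → ∫ x, φ i x * φ j x ∂P = 0) :
    Orthonormal ℝ fun i => (hφ i).toLp (φ i) := by
  refine ⟨fun i => ?_, fun i j hij => (inner_toLp_toLp _ _).trans (horth i j hij)⟩
  rw [← sq_eq_sq₀ (norm_nonneg _) zero_le_one, sq_norm_toLp, hone, one_pow]

theorem integral_sum_mul_sq {φ : ι → α → ℝ} {hφ : ∀ i, MemLp (φ i) 2 P}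
    (hO : Orthonormal ℝ fun i => (hφ i).toLp (φ i)) (s : Finset ι) (c : ι → ℝ) :
    ∫ x, (∑ i ∈ s, c i * φ i x) ^ 2 ∂P = ∑ i ∈ s, c i ^ 2 := by
  rw [← sq_norm_toLp (memLp_finsetSum s fun i _ => (hφ i).const_mul (c i)), toLp_sum_mul hφ,
    ← real_inner_self_eq_norm_sq, hO.inner_sum]
  simp only [conj_trivial, sq]

theorem sum_sq_integral_mul_le {φ : ι → α → ℝ} {hφ : ∀ i, MemLp (φ i) 2 P}
    (hO : Orthonormal ℝ fun i => (hφ i).toLp (φ i)) {f : α → ℝ} (hf : MemLp f 2 P)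
    (s : Finset ι) : ∑ i ∈ s, (∫ x, f x * φ i x ∂P) ^ 2 ≤ ∫ x, f x ^ 2 ∂P := by
  have hbessel := hO.sum_inner_products_le (hf.toLp f) (s := s)
  simpa only [inner_toLp_toLp, Real.norm_eq_abs, sq_abs, sq_norm_toLp, mul_comm] using hbessel

theorem hasSum_sq_of_orthonormal {H : Type*} [NormedAddCommGroup H] [InnerProductSpace ℝ H]
    {v : ι → H} (hv : Orthonormal ℝ v) {c : ι → ℝ} {x : H} (hx : HasSum (fun i => c i • v i) x) :
    HasSum (fun i => c i ^ 2) (‖x‖ ^ 2) := by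
  classical
  have hcoeff (i : ι) : inner ℝ x (v i) = c i := by
    have h := hx.mapL (innerSL ℝ (v i))
    simp only [innerSL_apply_apply, inner_smul_right, orthonormal_iff_ite.1 hv, mul_ite, mul_one,
      mul_zero] at h
    rw [real_inner_comm]
    refine h.unique ?_
    simpa using hasSum_single (f := fun j => if i = j then c j else 0) i fun j hj => if_neg hj.symm
  have h := hx.mapL (innerSL ℝ x)
  simpa only [innerSL_apply_apply, inner_smul_right, hcoeff, ← sq, real_inner_self_eq_norm_sq]
    using h

end L2

theorem memLp_two_mul_prod {α β : Type*} [MeasurableSpace α] [MeasurableSpace β] {P : Measure α}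
    {Q : Measure β} [SFinite P] [SFinite Q] {f : α → ℝ} {g : β → ℝ} (hf : MemLp f 2 P)
    (hg : MemLp g 2 Q) : MemLp (fun p : α × β => f p.1 * g p.2) 2 (P.prod Q) := by
  refine (memLp_two_iff_integrable_sq (hf.1.comp_fst.mul hg.1.comp_snd)).2 ?_
  simpa only [Pi.mul_apply, mul_pow] using hf.integrable_sq.mul_prod hg.integrable_sq

section Spectral

variable {α ι : Type*} [MeasurableSpace α]

/-- The `s`-th partial sum of the expansion of a kernel with eigenvalues `lam` and eigenfunctions
`φ`. -/
def truncatedKernel (lam : ι → ℝ) (φ : ι → α → ℝ) (s : Finset ι) (x y : α) : ℝ :=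
  ∑ i ∈ s, lam i * φ i x * φ i y

/-- The squared `L²(P)` norm of the section `κ x` of a kernel. -/
noncomputable def sectionSqNorm (P : Measure α) (κ : α → α → ℝ) (x : α) : ℝ := ∫ y, κ x y ^ 2 ∂P

namespace IsSpectralDecomposition

variable {P : Measure α} {κ : α → α → ℝ} {lam : ι → ℝ} {φ : ι → α → ℝ}

theorem orthonormal (h : IsSpectralDecomposition P κ lam φ) :
    Orthonormal ℝ fun i => (h.memLp i).toLp (φ i) :=
  orthonormal_toLp h.memLp h.norm_one h.orthogonal

theorem measurable_truncatedKernel (h : IsSpectralDecomposition P κ lam φ) (s : Finset ι) :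
    Measurable (Function.uncurry (truncatedKernel lam φ s)) :=
  Finset.measurable_sum s fun i _ =>
    (((h.measurable i).comp measurable_fst).const_mul _).mul ((h.measurable i).comp measurable_snd)

theorem tendsto_eLpNorm_truncatedKernel (h : IsSpectralDecomposition P κ lam φ) :
    Tendsto (fun s => eLpNorm (Function.uncurry (truncatedKernel lam φ s) - Function.uncurry κ) 2
      (P.prod P)) atTop (𝓝 0) := by
  have hsqrt : Tendsto (fun t : ℝ≥0∞ => t ^ (2⁻¹ : ℝ)) (𝓝 0) (𝓝 0) := by
    simpa using (ENNReal.continuous_rpow_const (y := (2⁻¹ : ℝ))).tendsto 0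
  refine (hsqrt.comp h.expansion).congr fun s => ?_
  rw [eLpNorm_sub_comm, eLpNorm_eq_lintegral_rpow_enorm_toReal two_ne_zero ENNReal.ofNat_ne_top]
  simp [Function.uncurry, truncatedKernel]

section SFinite

variable [SFinite P]

theorem orthonormal_mul_prod (h : IsSpectralDecomposition P κ lam φ) :
    Orthonormal ℝ fun i => (memLp_two_mul_prod (h.memLp i) (h.memLp i)).toLp
      fun p : α × α => φ i p.1 * φ i p.2 := by
  refine orthonormal_toLp (φ := fun i (p : α × α) => φ i p.1 * φ i p.2) _ (fun i => ?_)
    fun i j hij => ?_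
  · calc ∫ p : α × α, (φ i p.1 * φ i p.2) ^ 2 ∂(P.prod P)
        = ∫ p : α × α, φ i p.1 ^ 2 * φ i p.2 ^ 2 ∂(P.prod P) := by simp only [mul_pow]
      _ = 1 := by
          rw [integral_prod_mul (fun x => φ i x ^ 2) fun x => φ i x ^ 2, h.norm_one, mul_one]
  · calc ∫ p : α × α, φ i p.1 * φ i p.2 * (φ j p.1 * φ j p.2) ∂(P.prod P)
        = ∫ p : α × α, φ i p.1 * φ j p.1 * (φ i p.2 * φ j p.2) ∂(P.prod P) := by
          simp only [mul_mul_mul_comm]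
      _ = 0 := by
          rw [integral_prod_mul (fun x => φ i x * φ j x) fun x => φ i x * φ j x,
            h.orthogonal i j hij, mul_zero]

theorem memLp_truncatedKernel (h : IsSpectralDecomposition P κ lam φ) (s : Finset ι) :
    MemLp (Function.uncurry (truncatedKernel lam φ s)) 2 (P.prod P) := by
  refine (memLp_finsetSum s fun i _ =>
    (memLp_two_mul_prod (h.memLp i) (h.memLp i)).const_mul (lam i)).congr_norm
      (h.measurable_truncatedKernel s).aestronglyMeasurable (ae_of_all _ fun p => ?_)
  simp only [Function.uncurry, truncatedKernel, mul_assoc]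

theorem memLp_uncurry (h : IsSpectralDecomposition P κ lam φ)
    (hκ : Measurable (Function.uncurry κ)) : MemLp (Function.uncurry κ) 2 (P.prod P) := by
  obtain ⟨s, hs⟩ :=
    (h.tendsto_eLpNorm_truncatedKernel.eventually (gt_mem_nhds ENNReal.zero_lt_top)).exists
  have hsub : MemLp (Function.uncurry (truncatedKernel lam φ s) - Function.uncurry κ) 2
      (P.prod P) :=
    ⟨((h.measurable_truncatedKernel s).sub hκ).aestronglyMeasurable, hs⟩
  simpa using (h.memLp_truncatedKernel s).sub hsub

theorem ae_memLp (h : IsSpectralDecomposition P κ lam φ) (hκ : Measurable (Function.uncurry κ)) :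
    ∀ᵐ x ∂P, MemLp (κ x) 2 P := by
  filter_upwards [(h.memLp_uncurry hκ).integrable_sq.prod_right_ae] with x hx
  exact (memLp_two_iff_integrable_sq hκ.of_uncurry_left.aestronglyMeasurable).2 hx

theorem hasSum_sq_eigenvalue (h : IsSpectralDecomposition P κ lam φ)
    (hκ : Measurable (Function.uncurry κ)) :
    HasSum (fun i => lam i ^ 2) (∫ x, sectionSqNorm P κ x ∂P) := by
  have hL := h.memLp_uncurry hκ
  have hexp : HasSum (fun i => lam i • (memLp_two_mul_prod (h.memLp i) (h.memLp i)).toLp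
      fun p : α × α => φ i p.1 * φ i p.2) (hL.toLp _) := by
    refine ((Lp.tendsto_Lp_iff_tendsto_eLpNorm'' _ h.memLp_truncatedKernel _ hL).2
      h.tendsto_eLpNorm_truncatedKernel).congr fun s => ?_
    rw [← toLp_sum_mul]
    simp only [Function.uncurry_def, truncatedKernel, mul_assoc]
  have hsum := hasSum_sq_of_orthonormal h.orthonormal_mul_prod hexp
  rwa [sq_norm_toLp, integral_prod _ hL.integrable_sq] at hsum

theorem sum_sq_eigenvalue_le (h : IsSpectralDecomposition P κ lam φ)
    (hκ : Measurable (Function.uncurry κ)) (s : Finset ι) :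
    ∑ i ∈ s, lam i ^ 2 ≤ ∫ x, sectionSqNorm P κ x ∂P :=
  sum_le_hasSum s (fun i _ => sq_nonneg (lam i)) (h.hasSum_sq_eigenvalue hκ)

end SFinite

theorem eigenvalue_mul_integral_eq_zero [IsFiniteMeasure P]
    (h : IsSpectralDecomposition P κ lam φ) (hκ : Measurable (Function.uncurry κ))
    (hcent : ∀ᵐ y ∂P, ∫ x, κ x y ∂P = 0) (i : ι) : lam i * ∫ x, φ i x ∂P = 0 := by
  have hint : Integrable (Function.uncurry fun x y => κ x y * φ i y) (P.prod P) :=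
    (h.memLp_uncurry hκ).integrable_mul ((h.memLp i).comp_snd P)
  rw [← integral_const_mul, ← integral_congr_ae (h.eigen i), integral_integral_swap hint]
  refine integral_eq_zero_of_ae ?_
  filter_upwards [hcent] with y hy
  rw [integral_mul_const, hy, zero_mul, Pi.zero_apply]

end IsSpectralDecomposition

end Spectral

section KernelCombination

variable {α J : Type*} [Fintype J]

/-- The linear combination, with coefficients `a`, of the sections of a kernel at the points of a
sample `z`. The witness function is of this form, up to a constant. -/
def kernelCombination (κ : α → α → ℝ) (a : J → ℝ) (z : J → α) (x : α) : ℝ := ∑ j, a j * κ (z j) x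

variable [MeasurableSpace α] {P : Measure α} [IsProbabilityMeasure P]

theorem ae_pi_forall {p : α → Prop} (hp : ∀ᵐ x ∂P, p x) :
    ∀ᵐ z ∂(Measure.pi fun _ : J => P), ∀ j, p (z j) :=
  ae_all_iff.2 fun j =>
    (measurePreserving_eval (fun _ : J => P) j).quasiMeasurePreserving.ae hp

end KernelCombination

section FeatureMap

variable {α ι : Type*}

/-- The eigenvalues times the eigenfunctions with index in `s`, as the coordinates of a vector;
under `P` its coordinates at `x` are the coefficients of the section of the kernel at `x`. -/
noncomputable def featureMap (lam : ι → ℝ) (φ : ι → α → ℝ) (s : Finset ι) (x : α) :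
    EuclideanSpace ℝ s :=
  WithLp.toLp 2 fun i => lam i * φ i x

theorem sq_norm_sum_smul_featureMap {J : Type*} [Fintype J] (lam : ι → ℝ) (φ : ι → α → ℝ)
    (s : Finset ι) (a : J → ℝ) (z : J → α) :
    ‖∑ j, a j • featureMap lam φ s (z j)‖ ^ 2 = ∑ i ∈ s, (∑ j, a j * (lam i * φ i (z j))) ^ 2 := by
  rw [EuclideanSpace.real_norm_sq_eq, ← Finset.sum_coe_sort s]
  simp [featureMap]

theorem sq_norm_featureMap (lam : ι → ℝ) (φ : ι → α → ℝ) (s : Finset ι) (x : α) :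
    ‖featureMap lam φ s x‖ ^ 2 = ∑ i ∈ s, (lam i * φ i x) ^ 2 := by
  simpa using sq_norm_sum_smul_featureMap lam φ s (fun _ : Unit => 1) fun _ => x

namespace IsSpectralDecomposition

variable [MeasurableSpace α] {P : Measure α} {κ : α → α → ℝ} {lam : ι → ℝ} {φ : ι → α → ℝ}

theorem measurable_featureMap (h : IsSpectralDecomposition P κ lam φ) (s : Finset ι) :
    Measurable (featureMap lam φ s) :=
  (WithLp.measurable_toLp 2 _).comp
    (measurable_pi_lambda _ fun i : s => (h.measurable i).const_mul (lam i))

theorem integral_sq_norm_featureMap (h : IsSpectralDecomposition P κ lam φ) (s : Finset ι) :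
    ∫ x, ‖featureMap lam φ s x‖ ^ 2 ∂P = ∑ i ∈ s, lam i ^ 2 := by
  simp_rw [sq_norm_featureMap, mul_pow]
  rw [integral_finsetSum _ fun i _ => (h.memLp i).integrable_sq.const_mul _]
  simp_rw [integral_const_mul, h.norm_one, mul_one]

variable [IsProbabilityMeasure P]

theorem ae_sq_norm_featureMap_le (h : IsSpectralDecomposition P κ lam φ)
    (hκ : Measurable (Function.uncurry κ)) (s : Finset ι) :
    ∀ᵐ x ∂P, ‖featureMap lam φ s x‖ ^ 2 ≤ sectionSqNorm P κ x := by
  filter_upwards [h.ae_memLp hκ, (Finset.eventually_all s).2 fun i _ => h.eigen i] with x hx hcoeff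
  rw [sq_norm_featureMap, ← Finset.sum_congr rfl fun i hi => congrArg (· ^ 2) (hcoeff i hi)]
  exact sum_sq_integral_mul_le h.orthonormal hx s

theorem ae_pow_four_norm_featureMap_le (h : IsSpectralDecomposition P κ lam φ)
    (hκ : Measurable (Function.uncurry κ)) (s : Finset ι) :
    ∀ᵐ x ∂P, ‖featureMap lam φ s x‖ ^ 4 ≤ sectionSqNorm P κ x ^ 2 := by
  filter_upwards [h.ae_sq_norm_featureMap_le hκ s] with x hx
  simpa only [← pow_mul] using pow_le_pow_left₀ (sq_nonneg _) hx 2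

theorem memLp_four_featureMap (h : IsSpectralDecomposition P κ lam φ)
    (hκ : Measurable (Function.uncurry κ))
    (hG : Integrable (fun x => sectionSqNorm P κ x ^ 2) P) (s : Finset ι) :
    MemLp (featureMap lam φ s) 4 P := by
  have hm := (h.measurable_featureMap s).aestronglyMeasurable (μ := P)
  refine (integrable_norm_rpow_iff hm (by norm_num) (by norm_num)).1 ?_
  have hpow : Integrable (fun x => ‖featureMap lam φ s x‖ ^ 4) P :=
    hG.mono' (hm.norm.pow 4) <| by
      simpa [abs_of_nonneg] using h.ae_pow_four_norm_featureMap_le hκ s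
  exact_mod_cast hpow

theorem integral_featureMap (h : IsSpectralDecomposition P κ lam φ)
    (hκ : Measurable (Function.uncurry κ)) (hcent : ∀ᵐ y ∂P, ∫ x, κ x y ∂P = 0) (s : Finset ι) :
    ∫ x, featureMap lam φ s x ∂P = 0 := by
  ext i
  rw [eval_integral_piLp fun i : s => ((h.memLp i).integrable one_le_two).const_mul (lam i)]
  exact (integral_const_mul _ _).trans (h.eigenvalue_mul_integral_eq_zero hκ hcent i)

theorem ae_sq_norm_sum_smul_featureMap_le (h : IsSpectralDecomposition P κ lam φ)
    (hκ : Measurable (Function.uncurry κ)) (hcent : ∀ᵐ x ∂P, ∫ y, κ x y ∂P = 0) {J : Type*}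
    [Fintype J] (a : J → ℝ) (s : Finset ι) :
    ∀ᵐ z ∂(Measure.pi fun _ : J => P),
      ‖∑ j, a j • featureMap lam φ s (z j)‖ ^ 2 ≤ Var[kernelCombination κ a z; P] := by
  filter_upwards [ae_pi_forall (h.ae_memLp hκ), ae_pi_forall hcent,
    ae_pi_forall ((Finset.eventually_all s).2 fun i _ => h.eigen i)] with z hL hz hcoeff
  have hmem : MemLp (kernelCombination κ a z) 2 P :=
    memLp_finsetSum _ fun j _ => (hL j).const_mul (a j)
  have hmean : ∫ x, kernelCombination κ a z x ∂P = 0 := by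
    simp only [kernelCombination]
    rw [integral_finsetSum _ fun j _ => ((hL j).integrable one_le_two).const_mul _]
    simp [integral_const_mul, hz]
  have hint : ∀ j i, Integrable (fun x => κ (z j) x * φ i x) P := fun j i =>
    (hL j).integrable_mul (h.memLp i)
  have hinner : ∀ i ∈ s, ∫ x, kernelCombination κ a z x * φ i x ∂P
      = ∑ j, a j * (lam i * φ i (z j)) := fun i hi => by
    simp only [kernelCombination, Finset.sum_mul, mul_assoc]
    rw [integral_finsetSum _ fun j _ => (hint j i).const_mul _]
    simp_rw [integral_const_mul, hcoeff _ i hi]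
  rw [variance_of_integral_eq_zero hmem.aemeasurable hmean, sq_norm_sum_smul_featureMap,
    ← Finset.sum_congr rfl fun i hi => congrArg (· ^ 2) (hinner i hi)]
  exact sum_sq_integral_mul_le h.orthonormal hmem s

end IsSpectralDecomposition

end FeatureMap

section KernelSmallBall

variable {α J : Type*} [MeasurableSpace α] {P : Measure α} [IsProbabilityMeasure P] [Fintype J]

theorem measureReal_sq_norm_sum_smul_comp_le {E : Type*} [NormedAddCommGroup E]
    [InnerProductSpace ℝ E] [FiniteDimensional ℝ E] [MeasurableSpace E] [BorelSpace E]
    {b : α → E} (hb : Measurable b) (hcent : ∫ x, b x ∂P = 0) (hb4 : MemLp b 4 P)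
    (a : J → ℝ) {r : ℝ} (hr : 0 < r) :
    (Measure.pi fun _ : J => P).real {z | ‖∑ j, a j • b (z j)‖ ^ 2 ≤ r} ≤
      smallBallConst * ((√(1 + (∑ j, a j ^ 2) * (∫ x, ‖b x‖ ^ 2 ∂P) / r))⁻¹ +
        (∑ j, a j ^ 4) / r ^ 2 * ∫ x, ‖b x‖ ^ 4 ∂P) := by
  have : IsProbabilityMeasure (P.map b) := Measure.isProbabilityMeasure_map hb.aemeasurable
  have hball := measureReal_sq_norm_sum_smul_le (μ := P.map b)
    (by rwa [integral_map hb.aemeasurable (by fun_prop)])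
    ((memLp_map_measure_iff (by fun_prop) hb.aemeasurable).2 hb4) a hr
  rw [integral_map hb.aemeasurable (Continuous.aestronglyMeasurable (by fun_prop)),
    integral_map hb.aemeasurable (Continuous.aestronglyMeasurable (by fun_prop)),
    ← Measure.pi_map_pi fun _ => hb.aemeasurable,
    map_measureReal_apply (by fun_prop) (measurableSet_le (by fun_prop) measurable_const)] at hball
  exact hball

namespace IsSpectralDecomposition

variable {ι : Type*} {κ : α → α → ℝ} {lam : ι → ℝ} {φ : ι → α → ℝ}

theorem measureReal_variance_kernelCombination_le_sum (h : IsSpectralDecomposition P κ lam φ)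
    (hκ : Measurable (Function.uncurry κ)) (hright : ∀ᵐ x ∂P, ∫ y, κ x y ∂P = 0)
    (hleft : ∀ᵐ y ∂P, ∫ x, κ x y ∂P = 0)
    (hG : Integrable (fun x => sectionSqNorm P κ x ^ 2) P) (a : J → ℝ) {r : ℝ} (hr : 0 < r)
    (s : Finset ι) :
    (Measure.pi fun _ : J => P).real {z | Var[kernelCombination κ a z; P] ≤ r} ≤
      smallBallConst * ((√(1 + (∑ j, a j ^ 2) * (∑ i ∈ s, lam i ^ 2) / r))⁻¹ +
        (∑ j, a j ^ 4) / r ^ 2 * ∫ x, sectionSqNorm P κ x ^ 2 ∂P) := by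
  have hb4 := h.memLp_four_featureMap hκ hG s
  calc (Measure.pi fun _ : J => P).real {z | Var[kernelCombination κ a z; P] ≤ r}
      ≤ (Measure.pi fun _ : J => P).real {z | ‖∑ j, a j • featureMap lam φ s (z j)‖ ^ 2 ≤ r} := by
        refine ENNReal.toReal_mono (measure_ne_top _ _) (measure_mono_ae ?_)
        filter_upwards [h.ae_sq_norm_sum_smul_featureMap_le hκ hright a s] with z hz hzr
        exact hz.trans hzr
    _ ≤ _ := measureReal_sq_norm_sum_smul_comp_le (h.measurable_featureMap s)
        (h.integral_featureMap hκ hleft s) hb4 a hr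
    _ ≤ _ := by
        rw [h.integral_sq_norm_featureMap]
        have := smallBallConst_nonneg
        have hpow := integral_mono_ae (hb4.integrable_norm_pow (by norm_num)) hG
          (h.ae_pow_four_norm_featureMap_le hκ s)
        have : 0 ≤ ∑ j, a j ^ 4 := Finset.sum_nonneg fun j _ => by positivity
        gcongr

/-- The constants of the small-ball inequality do not depend on the dimension, so the truncation `s`
can be let grow to the full spectral decomposition. -/
theorem measureReal_variance_kernelCombination_le (h : IsSpectralDecomposition P κ lam φ)
    (hκ : Measurable (Function.uncurry κ)) (hright : ∀ᵐ x ∂P, ∫ y, κ x y ∂P = 0)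
    (hleft : ∀ᵐ y ∂P, ∫ x, κ x y ∂P = 0)
    (hG : Integrable (fun x => sectionSqNorm P κ x ^ 2) P) (a : J → ℝ) {r : ℝ} (hr : 0 < r) :
    (Measure.pi fun _ : J => P).real {z | Var[kernelCombination κ a z; P] ≤ r} ≤
      smallBallConst * ((√(1 + (∑ j, a j ^ 2) * (∫ x, sectionSqNorm P κ x ∂P) / r))⁻¹ +
        (∑ j, a j ^ 4) / r ^ 2 * ∫ x, sectionSqNorm P κ x ^ 2 ∂P) := by
  have hpos : 0 < 1 + (∑ j, a j ^ 2) * (∫ x, sectionSqNorm P κ x ∂P) / r := by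
    have : 0 ≤ ∫ x, sectionSqNorm P κ x ∂P :=
      (h.hasSum_sq_eigenvalue hκ).nonneg fun i => sq_nonneg (lam i)
    positivity
  have hsum : Tendsto (fun s => ∑ i ∈ s, lam i ^ 2) atTop (𝓝 (∫ x, sectionSqNorm P κ x ∂P)) :=
    h.hasSum_sq_eigenvalue hκ
  refine ge_of_tendsto' (x := atTop) ?_ fun s =>
    h.measureReal_variance_kernelCombination_le_sum hκ hright hleft hG a hr s
  refine ((Tendsto.inv₀ ?_ (Real.sqrt_pos.2 hpos).ne').add_const _).const_mul _
  exact (((hsum.const_mul _).div_const _).const_add _).sqrt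

end IsSpectralDecomposition

end KernelSmallBall

theorem ae_tendsto_of_tsum_eLpNorm_sub_ne_top {α : Type*} [MeasurableSpace α] {μ : Measure α}
    {g : ℕ → α → ℝ} {f : α → ℝ} (hg : ∀ n, AEStronglyMeasurable (g n) μ)
    (hf : AEStronglyMeasurable f μ) (hsum : ∑' n, eLpNorm (g n - f) 1 μ ≠ ∞) :
    ∀ᵐ x ∂μ, Tendsto (fun n => g n x) atTop (𝓝 (f x)) := by
  filter_upwards [summable_norm_of_tsum_eLpNorm_ne_top le_rfl (fun n => (hg n).sub hf) hsum]
    with x hx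
  exact tendsto_iff_norm_sub_tendsto_zero.2 hx.tendsto_atTop_zero

section CondMean

variable {𝒳 𝒱 ι : Type*} [MeasurableSpace 𝒳] [MeasurableSpace 𝒱]

/-- The conditional expectation of `g(X)` given `V`, where `(X, V)` has the law `ρ`, as a function
of `(X, V)`. -/
noncomputable def condMean (ρ : Measure (𝒳 × 𝒱)) (g : 𝒳 → ℝ) : 𝒳 × 𝒱 → ℝ :=
  ρ[fun p : 𝒳 × 𝒱 => g p.1 | MeasurableSpace.comap Prod.snd inferInstance]

variable {ρ : Measure (𝒳 × 𝒱)}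

theorem measurable_condMean (ρ : Measure (𝒳 × 𝒱)) (g : 𝒳 → ℝ) : Measurable (condMean ρ g) :=
  (stronglyMeasurable_condExp.mono measurable_snd.comap_le).measurable

theorem integrable_comp_fst {g : 𝒳 → ℝ} (hg : Integrable g ρ.fst) :
    Integrable (fun p : 𝒳 × 𝒱 => g p.1) ρ :=
  hg.comp_measurable measurable_fst

theorem condMean_sum_mul (s : Finset ι) (c : ι → ℝ) {g : ι → 𝒳 → ℝ}
    (hg : ∀ i ∈ s, Integrable (g i) ρ.fst) :
    condMean ρ (fun x => ∑ i ∈ s, c i * g i x) =ᵐ[ρ]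
      fun p => ∑ i ∈ s, c i * condMean ρ (g i) p := by
  have hsum := condExp_finsetSum (μ := ρ) (f := fun i => c i • fun p : 𝒳 × 𝒱 => g i p.1)
    (fun i hi => (integrable_comp_fst (hg i hi)).smul (c i))
    (MeasurableSpace.comap Prod.snd inferInstance)
  have hsmul : ∀ᵐ p ∂ρ, ∀ i ∈ s, (ρ[c i • fun p : 𝒳 × 𝒱 => g i p.1 |
      MeasurableSpace.comap Prod.snd inferInstance]) p = c i * condMean ρ (g i) p :=
    (Finset.eventually_all s).2 fun i _ => condExp_smul (c i) _ _
  have heq : (fun p : 𝒳 × 𝒱 => ∑ i ∈ s, c i * g i p.1)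
      = ∑ i ∈ s, c i • fun p : 𝒳 × 𝒱 => g i p.1 := by
    ext p
    simp
  filter_upwards [hsum, hsmul] with p hp hi
  rw [condMean, heq, hp, Finset.sum_apply, Finset.sum_congr rfl hi]

theorem condMean_add_const [IsFiniteMeasure ρ] {g : 𝒳 → ℝ} (hg : Integrable g ρ.fst) (c : ℝ) :
    condMean ρ (fun x => g x + c) =ᵐ[ρ] fun p => condMean ρ g p + c := by
  have hadd := condExp_add (integrable_comp_fst hg) (integrable_const c)
    (MeasurableSpace.comap (Prod.snd : 𝒳 × 𝒱 → 𝒱) inferInstance)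
  rwa [condExp_const measurable_snd.comap_le] at hadd

theorem eLpNorm_condMean_sub_le {g f : 𝒳 → ℝ} (hg : Integrable g ρ.fst)
    (hf : Integrable f ρ.fst) :
    eLpNorm (condMean ρ g - condMean ρ f) 1 ρ ≤ eLpNorm (g - f) 1 ρ.fst := by
  rw [Measure.fst, eLpNorm_map_measure (hg.sub hf).1 measurable_fst.aemeasurable]
  exact (eLpNorm_congr_ae
    (condExp_sub (integrable_comp_fst hg) (integrable_comp_fst hf) _)).ge.trans
      (eLpNorm_condExp_le_eLpNorm _ le_rfl)

theorem ae_tendsto_condMean {g : ℕ → 𝒳 → ℝ} {f : 𝒳 → ℝ} (hg : ∀ n, Integrable (g n) ρ.fst)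
    (hf : Integrable f ρ.fst) (hsum : ∑' n, eLpNorm (g n - f) 1 ρ.fst ≠ ∞) :
    ∀ᵐ p ∂ρ, Tendsto (fun n => condMean ρ (g n) p) atTop (𝓝 (condMean ρ f p)) :=
  ae_tendsto_of_tsum_eLpNorm_sub_ne_top
    (fun n => (measurable_condMean ρ (g n)).aestronglyMeasurable)
    (measurable_condMean ρ f).aestronglyMeasurable
    (ne_top_of_le_ne_top hsum
      (ENNReal.tsum_le_tsum fun n => eLpNorm_condMean_sub_le (hg n) hf))

end CondMean

namespace LinearSmoother

variable {K 𝒳 𝒱 ι : Type*} [Fintype K] [MeasurableSpace 𝒳] [MeasurableSpace 𝒱]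
  (S : LinearSmoother K 𝒳 𝒱) {ρ : Measure (𝒳 × 𝒱)}

/-- The error `E[g(X) | V] - Ê[g(X) | V]` as a function of the training sample and of the new
observation; `condMSE` is its mean square. -/
noncomputable def residual (ρ : Measure (𝒳 × 𝒱)) (g : 𝒳 → ℝ)
    (q : (K → 𝒳 × 𝒱) × (𝒳 × 𝒱)) : ℝ :=
  condMean ρ g q.2 - S.estimate g q.1 q.2.2

theorem condMSE_eq_lintegral_residual (ρ : Measure (𝒳 × 𝒱)) (g : 𝒳 → ℝ) :
    S.condMSE ρ g = ∫⁻ q, ‖S.residual ρ g q‖ₑ ^ 2 ∂((Measure.pi fun _ : K => ρ).prod ρ) := rfl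

theorem measurable_residual {g : 𝒳 → ℝ} (hg : Measurable g) : Measurable (S.residual ρ g) := by
  refine ((measurable_condMean ρ g).comp measurable_snd).sub
    (Finset.measurable_sum _ fun j _ => Measurable.mul ?_ (by fun_prop))
  exact (S.measurable_weight j).comp (measurable_fst.prodMk (measurable_snd.comp measurable_snd))

theorem estimate_sum_mul (s : Finset ι) (c : ι → ℝ) (g : ι → 𝒳 → ℝ) (D : K → 𝒳 × 𝒱) (v : 𝒱) :
    S.estimate (fun x => ∑ i ∈ s, c i * g i x) D v = ∑ i ∈ s, c i * S.estimate (g i) D v := by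
  simp only [estimate, Finset.mul_sum, mul_left_comm (c _)]
  exact Finset.sum_comm

theorem residual_sum_mul (s : Finset ι) (c : ι → ℝ) {g : ι → 𝒳 → ℝ}
    (hg : ∀ i ∈ s, Integrable (g i) ρ.fst) :
    ∀ᵐ q ∂((Measure.pi fun _ : K => ρ).prod ρ),
      S.residual ρ (fun x => ∑ i ∈ s, c i * g i x) q = ∑ i ∈ s, c i * S.residual ρ (g i) q := by
  filter_upwards [Measure.quasiMeasurePreserving_snd.ae (condMean_sum_mul s c hg)] with q hq
  simp only [residual, hq, estimate_sum_mul, mul_sub, Finset.sum_sub_distrib]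

variable {S} [IsProbabilityMeasure ρ]

theorem AffineEquivariant.condMSE_add_const (hS : S.AffineEquivariant ρ) {g : 𝒳 → ℝ}
    (hgm : Measurable g) (hg : Integrable g ρ.fst) (c : ℝ) :
    S.condMSE ρ (fun x => g x + c) = S.condMSE ρ g := by
  have hmp : MeasurePreserving (Prod.map id Prod.snd : (K → 𝒳 × 𝒱) × (𝒳 × 𝒱) → (K → 𝒳 × 𝒱) × 𝒱)
      ((Measure.pi fun _ : K => ρ).prod ρ) ((Measure.pi fun _ : K => ρ).prod ρ.snd) :=
    (MeasurePreserving.id _).prod ⟨measurable_snd, rfl⟩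
  simp only [condMSE_eq_lintegral_residual]
  refine lintegral_congr_ae ?_
  filter_upwards [Measure.quasiMeasurePreserving_snd.ae (condMean_add_const hg c),
    hmp.quasiMeasurePreserving.ae (hS g hgm 1 c)] with q hmean hest
  simp only [one_mul, Prod.map_fst, Prod.map_snd, id] at hest
  rw [residual, residual, hmean, hest, add_sub_add_right_eq_sub]

theorem AffineEquivariant.crossFitRatio_add_const (hS : S.AffineEquivariant ρ) {g : 𝒳 → ℝ}
    (hgm : Measurable g) (hg : Integrable g ρ.fst) (c : ℝ) :
    S.crossFitRatio ρ (fun x => g x + c) = S.crossFitRatio ρ g := by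
  rw [crossFitRatio, crossFitRatio, hS.condMSE_add_const hgm hg c,
    variance_add_const hgm.aestronglyMeasurable]

theorem condMSE_le_liminf (S : LinearSmoother K 𝒳 𝒱) {g : ℕ → 𝒳 → ℝ} {f : 𝒳 → ℝ}
    (hgm : ∀ n, Measurable (g n)) (hg : ∀ n, Integrable (g n) ρ.fst) (hf : Integrable f ρ.fst)
    (hsum : ∑' n, eLpNorm (g n - f) 1 ρ.fst ≠ ∞) :
    S.condMSE ρ f ≤ liminf (fun n => S.condMSE ρ (g n)) atTop := by
  have hpt : ∀ᵐ p ∂ρ, Tendsto (fun n => g n p.1) atTop (𝓝 (f p.1)) :=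
    ae_of_ae_map measurable_fst.aemeasurable
      (ae_tendsto_of_tsum_eLpNorm_sub_ne_top (fun n => (hg n).1) hf.1 hsum)
  have hres : ∀ᵐ q ∂((Measure.pi fun _ : K => ρ).prod ρ),
      Tendsto (fun n => ‖S.residual ρ (g n) q‖ₑ ^ 2) atTop (𝓝 (‖S.residual ρ f q‖ₑ ^ 2)) := by
    filter_upwards [Measure.quasiMeasurePreserving_fst.ae (ae_pi_forall hpt),
      Measure.quasiMeasurePreserving_snd.ae (ae_tendsto_condMean hg hf hsum)] with q hq hmean
    have hlim : Tendsto (fun n => S.residual ρ (g n) q) atTop (𝓝 (S.residual ρ f q)) :=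
      hmean.sub (tendsto_finsetSum _ fun j _ => (hq j).const_mul _)
    exact ((ENNReal.continuous_pow 2).tendsto _).comp hlim.enorm
  simp only [condMSE_eq_lintegral_residual]
  rw [lintegral_congr_ae (hres.mono fun q hq => hq.liminf_eq.symm)]
  exact lintegral_liminf_le fun n => (S.measurable_residual (hgm n)).enorm.pow_const 2

end LinearSmoother

section SecondMoment

variable {α J ι : Type*} [MeasurableSpace α] [Fintype J] {P : Measure α}

theorem tsum_eLpNorm_kernelCombination_sub_ne_top {κs : ℕ → α → α → ℝ} {κ : α → α → ℝ}
    (hκs : ∀ n x, Measurable (κs n x)) (hκ : ∀ x, Measurable (κ x)) (a : J → ℝ) {z : J → α}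
    (hz : ∀ j, ∑' n, eLpNorm (κs n (z j) - κ (z j)) 1 P ≠ ∞) :
    ∑' n, eLpNorm (kernelCombination (κs n) a z - kernelCombination κ a z) 1 P ≠ ∞ := by
  have hle : ∀ n, eLpNorm (kernelCombination (κs n) a z - kernelCombination κ a z) 1 P
      ≤ ∑ j, ‖a j‖ₑ * eLpNorm (κs n (z j) - κ (z j)) 1 P := fun n => by
    have heq : kernelCombination (κs n) a z - kernelCombination κ a z
        = ∑ j, a j • (κs n (z j) - κ (z j)) := by
      ext x
      simp [kernelCombination, mul_sub]
    rw [heq]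
    simp only [← eLpNorm_const_smul]
    exact eLpNorm_sum_le (fun j _ => (((hκs n _).sub (hκ _)).const_smul _).aestronglyMeasurable)
      le_rfl
  refine ne_top_of_le_ne_top ?_ (ENNReal.tsum_le_tsum hle)
  rw [Summable.tsum_finsetSum fun _ _ => ENNReal.summable]
  simp only [ENNReal.tsum_mul_left]
  exact ENNReal.sum_ne_top.2 fun j _ => ENNReal.mul_ne_top enorm_ne_top (hz j)

variable [IsProbabilityMeasure P]

theorem lintegral_enorm_sum_mul_comp_sq (a : J → ℝ) {g : α → ℝ} (hg : MemLp g 2 P)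
    (hg0 : ∫ x, g x ∂P = 0) :
    ∫⁻ z, ‖∑ j, a j * g (z j)‖ₑ ^ 2 ∂(Measure.pi fun _ : J => P)
      = ENNReal.ofReal ((∑ j, a j ^ 2) * ∫ x, g x ^ 2 ∂P) := by
  have hterm : ∀ j, MemLp (fun z : J → α => a j * g (z j)) 2 (Measure.pi fun _ : J => P) :=
    fun j => (hg.comp_measurePreserving (measurePreserving_eval (fun _ : J => P) j)).const_mul _
  have hsum : MemLp (∑ j, fun z : J → α => a j * g (z j)) 2 (Measure.pi fun _ : J => P) :=
    memLp_finsetSum' _ fun j _ => hterm j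
  have hmean : ∫ z, (∑ j, fun z : J → α => a j * g (z j)) z ∂(Measure.pi fun _ : J => P) = 0 := by
    simp only [Finset.sum_apply]
    rw [integral_finsetSum _ fun j _ => (hterm j).integrable one_le_two]
    refine Finset.sum_eq_zero fun j _ => ?_
    rw [integral_const_mul, integral_comp_eval (μ := fun _ : J => P) hg.1, hg0, mul_zero]
  have hvar := variance_sum_pi (μ := fun _ : J => P) (X := fun j x => a j * g x)
    fun j => hg.const_mul (a j)
  rw [variance_of_integral_eq_zero hsum.1.aemeasurable hmean] at hvar
  simp_rw [variance_const_mul, variance_of_integral_eq_zero hg.1.aemeasurable hg0] at hvar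
  rw [Finset.sum_mul, ← hvar, ofReal_integral_eq_lintegral_ofReal hsum.integrable_sq
    (ae_of_all _ fun z => sq_nonneg _)]
  refine lintegral_congr fun z => ?_
  rw [← Real.enorm_of_nonneg (sq_nonneg _), enorm_pow, Finset.sum_apply]

namespace IsSpectralDecomposition

variable {κ : α → α → ℝ} {lam : ι → ℝ} {φ : ι → α → ℝ}

theorem lintegral_enorm_sum_truncatedKernel_sq (h : IsSpectralDecomposition P κ lam φ)
    (hκ : Measurable (Function.uncurry κ)) (hcent : ∀ᵐ y ∂P, ∫ x, κ x y ∂P = 0) (a : J → ℝ)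
    (s : Finset ι) (d : ι → ℝ) :
    ∫⁻ z, ‖∑ i ∈ s, (∑ j, a j * (lam i * φ i (z j))) * d i‖ₑ ^ 2 ∂(Measure.pi fun _ : J => P)
      = ENNReal.ofReal (∑ j, a j ^ 2) * ∑ i ∈ s, ENNReal.ofReal (lam i ^ 2) * ‖d i‖ₑ ^ 2 := by
  have hg : MemLp (fun x => ∑ i ∈ s, (lam i * d i) * φ i x) 2 P :=
    memLp_finsetSum _ fun i _ => (h.memLp i).const_mul _
  have hg0 : ∫ x, ∑ i ∈ s, (lam i * d i) * φ i x ∂P = 0 := by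
    rw [integral_finsetSum _ fun i _ => ((h.memLp i).integrable one_le_two).const_mul _]
    refine Finset.sum_eq_zero fun i _ => ?_
    rw [integral_const_mul, mul_right_comm, h.eigenvalue_mul_integral_eq_zero hκ hcent, zero_mul]
  have hswap : ∀ z : J → α, ∑ i ∈ s, (∑ j, a j * (lam i * φ i (z j))) * d i
      = ∑ j, a j * ∑ i ∈ s, (lam i * d i) * φ i (z j) := fun z => by
    simp_rw [Finset.sum_mul, Finset.mul_sum]
    rw [Finset.sum_comm]
    exact Finset.sum_congr rfl fun j _ => Finset.sum_congr rfl fun i _ => by ring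
  simp_rw [hswap]
  rw [lintegral_enorm_sum_mul_comp_sq a hg hg0, integral_sum_mul_sq h.orthonormal,
    ENNReal.ofReal_mul (by positivity),
    ENNReal.ofReal_sum_of_nonneg (s := s) fun i _ => sq_nonneg _]
  refine congrArg _ (Finset.sum_congr rfl fun i _ => ?_)
  rw [mul_pow, ENNReal.ofReal_mul (sq_nonneg _), ← Real.enorm_of_nonneg (sq_nonneg (d i)),
    enorm_pow]

theorem exists_seq_tsum_eLpNorm_ne_top (h : IsSpectralDecomposition P κ lam φ)
    (hκ : Measurable (Function.uncurry κ)) :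
    ∃ s : ℕ → Finset ι, ∀ᵐ x ∂P,
      ∑' n, eLpNorm (truncatedKernel lam φ (s n) x - κ x) 1 P ≠ ∞ := by
  have hmeas : ∀ s, Measurable (Function.uncurry (truncatedKernel lam φ s) - Function.uncurry κ) :=
    fun s => (h.measurable_truncatedKernel s).sub hκ
  have hex : ∀ n : ℕ, ∃ s : Finset ι,
      eLpNorm (Function.uncurry (truncatedKernel lam φ s) - Function.uncurry κ) 2 (P.prod P)
        < 2⁻¹ ^ n := fun n =>
    (h.tendsto_eLpNorm_truncatedKernel.eventually
      (gt_mem_nhds (ENNReal.pow_pos (ENNReal.inv_pos.2 ENNReal.ofNat_ne_top) n))).exists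
  choose s hs using hex
  have hprod : ∀ n, ∫⁻ x, eLpNorm (truncatedKernel lam φ (s n) x - κ x) 1 P ∂P
      = eLpNorm (Function.uncurry (truncatedKernel lam φ (s n)) - Function.uncurry κ) 1
        (P.prod P) := fun n => by
    simp only [eLpNorm_one_eq_lintegral_enorm]
    exact (lintegral_prod _ (hmeas (s n)).enorm.aemeasurable).symm
  have hsection : ∀ n, Measurable fun x => eLpNorm (truncatedKernel lam φ (s n) x - κ x) 1 P :=
    fun n => by
      simp only [eLpNorm_one_eq_lintegral_enorm]
      exact (hmeas (s n)).enorm.lintegral_prod_right'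
  have hsum : ∫⁻ x, ∑' n, eLpNorm (truncatedKernel lam φ (s n) x - κ x) 1 P ∂P ≤ 2 := by
    rw [lintegral_tsum fun n => (hsection n).aemeasurable, ← ENNReal.tsum_geometric_two]
    refine ENNReal.tsum_le_tsum fun n => ?_
    rw [hprod]
    exact (eLpNorm_le_eLpNorm_of_exponent_le one_le_two (hmeas _).aestronglyMeasurable).trans
      (hs n).le
  refine ⟨s, (ae_lt_top (Measurable.tsum hsection) ?_).mono fun x hx => hx.ne⟩
  exact ne_top_of_le_ne_top ENNReal.ofNat_ne_top hsum

end IsSpectralDecomposition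

end SecondMoment

theorem kernelCombination_truncatedKernel {α J ι : Type*} [Fintype J] (lam : ι → ℝ)
    (φ : ι → α → ℝ) (s : Finset ι) (a : J → ℝ) (z : J → α) :
    kernelCombination (truncatedKernel lam φ s) a z
      = fun x => ∑ i ∈ s, (∑ j, a j * (lam i * φ i (z j))) * φ i x := by
  ext x
  simp only [kernelCombination, truncatedKernel, Finset.mul_sum, Finset.sum_mul, mul_assoc]
  exact Finset.sum_comm

namespace LinearSmoother

variable {J K 𝒳 𝒱 ι : Type*} [Fintype J] [Fintype K] [MeasurableSpace 𝒳] [MeasurableSpace 𝒱]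
  (S : LinearSmoother K 𝒳 𝒱) {ρ : Measure (𝒳 × 𝒱)} {κ : 𝒳 → 𝒳 → ℝ} {lam : ι → ℝ}
  {φ : ι → 𝒳 → ℝ}

theorem condMSE_kernelCombination_truncatedKernel (hφ : ∀ i, Integrable (φ i) ρ.fst)
    (lam : ι → ℝ) (s : Finset ι) (a : J → ℝ) (z : J → 𝒳) :
    S.condMSE ρ (kernelCombination (truncatedKernel lam φ s) a z)
      = ∫⁻ q, ‖∑ i ∈ s, (∑ j, a j * (lam i * φ i (z j))) * S.residual ρ (φ i) q‖ₑ ^ 2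
        ∂((Measure.pi fun _ : K => ρ).prod ρ) := by
  rw [kernelCombination_truncatedKernel, condMSE_eq_lintegral_residual]
  refine lintegral_congr_ae ?_
  filter_upwards [S.residual_sum_mul s _ fun i _ => hφ i] with q hq
  rw [hq]

theorem measurable_sum_truncatedKernel_mul_residual (hφ : ∀ i, Measurable (φ i)) (lam : ι → ℝ)
    (s : Finset ι) (a : J → ℝ) :
    Measurable fun p : (J → 𝒳) × ((K → 𝒳 × 𝒱) × (𝒳 × 𝒱)) =>
      ∑ i ∈ s, (∑ j, a j * (lam i * φ i (p.1 j))) * S.residual ρ (φ i) p.2 :=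
  Finset.measurable_sum _ fun i _ =>
    Measurable.mul (by fun_prop) ((S.measurable_residual (hφ i)).comp measurable_snd)

variable [IsProbabilityMeasure ρ]

theorem measurable_condMSE_kernelCombination_truncatedKernel
    (h : IsSpectralDecomposition ρ.fst κ lam φ) (s : Finset ι) (a : J → ℝ) :
    Measurable fun z => S.condMSE ρ (kernelCombination (truncatedKernel lam φ s) a z) := by
  simp only [S.condMSE_kernelCombination_truncatedKernel
    fun i => (h.memLp i).integrable one_le_two]
  exact ((S.measurable_sum_truncatedKernel_mul_residual h.measurable lam s a).enorm.pow_const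
    2).lintegral_prod_right'

theorem lintegral_condMSE_kernelCombination_truncatedKernel_le
    (h : IsSpectralDecomposition ρ.fst κ lam φ) (hκ : Measurable (Function.uncurry κ))
    (hcent : ∀ᵐ y ∂ρ.fst, ∫ x, κ x y ∂ρ.fst = 0) (s : Finset ι) (a : J → ℝ) :
    ∫⁻ z, S.condMSE ρ (kernelCombination (truncatedKernel lam φ s) a z)
        ∂(Measure.pi fun _ : J => ρ.fst)
      ≤ ENNReal.ofReal (∑ j, a j ^ 2) * (ENNReal.ofReal (∫ x, sectionSqNorm ρ.fst κ x ∂ρ.fst)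
        * ⨆ i, S.condMSE ρ (φ i)) := by
  have hres : ∀ i, Measurable fun q => ENNReal.ofReal (lam i ^ 2) * ‖S.residual ρ (φ i) q‖ₑ ^ 2 :=
    fun i => ((S.measurable_residual (h.measurable i)).enorm.pow_const 2).const_mul _
  simp only [S.condMSE_kernelCombination_truncatedKernel
    fun i => (h.memLp i).integrable one_le_two]
  rw [lintegral_lintegral_swap ((S.measurable_sum_truncatedKernel_mul_residual h.measurable
    lam s a).enorm.pow_const 2).aemeasurable]
  simp only [h.lintegral_enorm_sum_truncatedKernel_sq hκ hcent]
  rw [lintegral_const_mul _ (Finset.measurable_sum _ fun i _ => hres i),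
    lintegral_finsetSum _ fun i _ => hres i]
  gcongr
  calc ∑ i ∈ s, ∫⁻ q, ENNReal.ofReal (lam i ^ 2) * ‖S.residual ρ (φ i) q‖ₑ ^ 2
        ∂((Measure.pi fun _ : K => ρ).prod ρ)
      = ∑ i ∈ s, ENNReal.ofReal (lam i ^ 2) * S.condMSE ρ (φ i) :=
        Finset.sum_congr rfl fun i _ =>
          lintegral_const_mul _ ((S.measurable_residual (h.measurable i)).enorm.pow_const 2)
    _ ≤ ∑ i ∈ s, ENNReal.ofReal (lam i ^ 2) * ⨆ i, S.condMSE ρ (φ i) :=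
        Finset.sum_le_sum fun i _ =>
          mul_le_mul_right (le_iSup (fun i => S.condMSE ρ (φ i)) i) _
    _ ≤ ENNReal.ofReal (∫ x, sectionSqNorm ρ.fst κ x ∂ρ.fst) * ⨆ i, S.condMSE ρ (φ i) := by
        rw [← Finset.sum_mul, ← ENNReal.ofReal_sum_of_nonneg fun i _ => sq_nonneg _]
        gcongr
        exact h.sum_sq_eigenvalue_le hκ s

theorem measure_le_condMSE_kernelCombination_le (h : IsSpectralDecomposition ρ.fst κ lam φ)
    (hκ : Measurable (Function.uncurry κ)) (hcent : ∀ᵐ y ∂ρ.fst, ∫ x, κ x y ∂ρ.fst = 0)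
    (a : J → ℝ) {t : ℝ≥0∞} (ht₀ : t ≠ 0) (ht : t ≠ ∞) :
    (Measure.pi fun _ : J => ρ.fst) {z | t ≤ S.condMSE ρ (kernelCombination κ a z)}
      ≤ ENNReal.ofReal (∑ j, a j ^ 2) * (ENNReal.ofReal (∫ x, sectionSqNorm ρ.fst κ x ∂ρ.fst)
        * ⨆ i, S.condMSE ρ (φ i)) / t := by
  obtain ⟨s, hs⟩ := h.exists_seq_tsum_eLpNorm_ne_top hκ
  set L : (J → 𝒳) → ℝ≥0∞ := fun z =>
    liminf (fun n => S.condMSE ρ (kernelCombination (truncatedKernel lam φ (s n)) a z)) atTop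
  have hmeas := fun n => S.measurable_condMSE_kernelCombination_truncatedKernel h (s n) a
  have hκx : ∀ x, Measurable (κ x) := fun x => hκ.of_uncurry_left
  have hκsx : ∀ n x, Measurable (truncatedKernel lam φ (s n) x) :=
    fun n x => (h.measurable_truncatedKernel (s n)).of_uncurry_left
  have hfatou : ∀ᵐ z ∂(Measure.pi fun _ : J => ρ.fst),
      S.condMSE ρ (kernelCombination κ a z) ≤ L z := by
    filter_upwards [ae_pi_forall (J := J) (h.ae_memLp hκ), ae_pi_forall (J := J) hs] with z hz hzs
    refine S.condMSE_le_liminf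
      (fun n => Finset.measurable_sum _ fun j _ => (hκsx n _).const_mul _) (fun n => ?_)
      (integrable_finsetSum _ fun j _ => ((hz j).integrable one_le_two).const_mul _)
      (tsum_eLpNorm_kernelCombination_sub_ne_top hκsx hκx a hzs)
    rw [kernelCombination_truncatedKernel]
    exact integrable_finsetSum _ fun i _ => ((h.memLp i).integrable one_le_two).const_mul _
  calc (Measure.pi fun _ : J => ρ.fst) {z | t ≤ S.condMSE ρ (kernelCombination κ a z)}
      ≤ (Measure.pi fun _ : J => ρ.fst) {z | t ≤ L z} :=
        measure_mono_ae (hfatou.mono fun z hz => le_trans' hz)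
    _ ≤ (∫⁻ z, L z ∂(Measure.pi fun _ : J => ρ.fst)) / t :=
        meas_ge_le_lintegral_div (Measurable.liminf hmeas).aemeasurable ht₀ ht
    _ ≤ _ := by
        gcongr
        exact (lintegral_liminf_le hmeas).trans (liminf_le_of_frequently_le' (.of_forall fun n =>
          S.lintegral_condMSE_kernelCombination_truncatedKernel_le h hκ hcent (s n) a))

end LinearSmoother

section Centering

theorem IsPosDefKernel.symm {𝒳 : Type*} {k : 𝒳 → 𝒳 → ℝ} (hk : IsPosDefKernel k) (x y : 𝒳) :
    k x y = k y x := by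
  simpa using (hk 2 ![x, y]).1.apply 1 0

theorem IsPosDefKernel.self_nonneg {𝒳 : Type*} {k : 𝒳 → 𝒳 → ℝ} (hk : IsPosDefKernel k) (x : 𝒳) :
    0 ≤ k x x := by
  simpa using (hk 1 ![x]).diag_nonneg (i := 0)

theorem IsPosDefKernel.abs_le {𝒳 : Type*} {k : 𝒳 → 𝒳 → ℝ} (hk : IsPosDefKernel k) (x y : 𝒳) :
    |k x y| ≤ √(k x x) * √(k y y) := by
  have hdet := (hk 2 ![x, y]).det_nonneg
  simp only [Matrix.det_fin_two, Matrix.of_apply, Matrix.cons_val_zero, Matrix.cons_val_one,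
    hk.symm y x] at hdet
  rw [← Real.sqrt_mul (hk.self_nonneg x)]
  exact Real.abs_le_sqrt (by linarith [sq (k x y)])

variable {𝒳 : Type*} [MeasurableSpace 𝒳] {P : Measure 𝒳} {k : 𝒳 → 𝒳 → ℝ}

theorem IsPosDefKernel.integrable_uncurry [SFinite P] (hk : IsPosDefKernel k)
    (hmeas : Measurable (Function.uncurry k)) (hint : Integrable (fun x => √(k x x)) P) :
    Integrable (Function.uncurry k) (P.prod P) :=
  (hint.mul_prod hint).mono' hmeas.aestronglyMeasurable (ae_of_all _ fun p => hk.abs_le p.1 p.2)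

theorem measurable_centeredKernel [SFinite P] (hk : Measurable (Function.uncurry k)) :
    Measurable (Function.uncurry (centeredKernel P k)) := by
  have hright : Measurable fun x => ∫ b, k x b ∂P :=
    (StronglyMeasurable.integral_prod_right (f := k) hk.stronglyMeasurable).measurable
  have hleft : Measurable fun y => ∫ a, k a y ∂P :=
    (StronglyMeasurable.integral_prod_left (f := k) hk.stronglyMeasurable).measurable
  exact ((hk.sub (hright.comp measurable_fst)).sub (hleft.comp measurable_snd)).add_const _

theorem centeredKernel_flip [SFinite P] (hk : Integrable (Function.uncurry k) (P.prod P))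
    (x y : 𝒳) : centeredKernel P (flip k) y x = centeredKernel P k x y := by
  simp only [centeredKernel, flip]
  rw [integral_integral_swap hk]
  ring

variable [IsProbabilityMeasure P]

theorem integral_centeredKernel_right (hk : Integrable (Function.uncurry k) (P.prod P)) :
    ∀ᵐ x ∂P, ∫ y, centeredKernel P k x y ∂P = 0 := by
  filter_upwards [hk.prod_right_ae] with x hx
  have hsec : Integrable (fun y => k x y) P := hx
  have hcol : Integrable (fun y => ∫ a, k a y ∂P) P := hk.integral_prod_right
  have hrow : Integrable (fun y => k x y - ∫ b, k x b ∂P) P := hsec.sub (integrable_const _)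
  have hdiff : Integrable (fun y => k x y - (∫ b, k x b ∂P) - ∫ a, k a y ∂P) P := hrow.sub hcol
  simp only [centeredKernel]
  rw [integral_add hdiff (integrable_const _), integral_sub hrow hcol,
    integral_sub hsec (integrable_const _), integral_integral_swap hk]
  simp

theorem integral_centeredKernel_left (hk : Integrable (Function.uncurry k) (P.prod P)) :
    ∀ᵐ y ∂P, ∫ x, centeredKernel P k x y ∂P = 0 := by
  filter_upwards [integral_centeredKernel_right (k := flip k) hk.swap] with y hy
  simpa only [centeredKernel_flip hk] using hy

end Centering

section NullRatio

variable {𝒳 ι : Type*} [MeasurableSpace 𝒳] {P : Measure 𝒳} {k : 𝒳 → 𝒳 → ℝ} {n : ℕ}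

theorem integral_expectedProduct_self (P : Measure 𝒳) (k : 𝒳 → 𝒳 → ℝ) :
    ∫ x, expectedProduct P k x x ∂P = ∫ x, sectionSqNorm P (centeredKernel P k) x ∂P := by
  simp only [expectedProduct, sectionSqNorm, sq]

theorem ofReal_sectionSqNorm {κ : 𝒳 → 𝒳 → ℝ} {x : 𝒳} (hx : MemLp (κ x) 2 P) :
    ENNReal.ofReal (sectionSqNorm P κ x) = ∫⁻ y, ‖κ x y‖ₑ ^ 2 ∂P := by
  rw [sectionSqNorm, ofReal_integral_eq_lintegral_ofReal hx.integrable_sq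
    (ae_of_all _ fun y => sq_nonneg _)]
  refine lintegral_congr fun y => ?_
  rw [← Real.enorm_of_nonneg (sq_nonneg _), enorm_pow]

theorem lintegral_ofReal_sectionSqNorm_sq {κ : 𝒳 → 𝒳 → ℝ} (hκ : ∀ x, Measurable (κ x))
    (hmem : ∀ᵐ x ∂P, MemLp (κ x) 2 P) :
    ∫⁻ x, ENNReal.ofReal (sectionSqNorm P κ x ^ 2) ∂P
      = ∫⁻ x₁, ∫⁻ x₂, ∫⁻ x₃, ‖κ x₁ x₂‖ₑ ^ 2 * ‖κ x₁ x₃‖ₑ ^ 2 ∂P ∂P ∂P := by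
  refine lintegral_congr_ae ?_
  filter_upwards [hmem] with x hx
  have hm : Measurable fun y => ‖κ x y‖ₑ ^ 2 := (hκ x).enorm.pow_const 2
  simp only [lintegral_const_mul _ hm]
  have hnonneg : 0 ≤ sectionSqNorm P κ x := integral_nonneg fun y => sq_nonneg _
  rw [lintegral_mul_const _ hm, ENNReal.ofReal_pow hnonneg, ofReal_sectionSqNorm hx, sq]

theorem denominator_ne_zero_of_nullRatio_ne_top (hr : nullRatio P k n ≠ ∞) :
    n ≠ 0 ∧ 0 < ∫ x, sectionSqNorm P (centeredKernel P k) x ∂P := by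
  rw [nullRatio, defRatio, integral_expectedProduct_self] at hr
  have hden := (ite_ne_left_iff.1 hr).1
  simpa using hden

variable [SFinite P] {lam : ι → ℝ} {φ : ι → 𝒳 → ℝ}

theorem IsSpectralDecomposition.lintegral_div_le_nullRatio
    (h : IsSpectralDecomposition P (centeredKernel P k) lam φ)
    (hk : Measurable (Function.uncurry k)) (hn : n ≠ 0) :
    (∫⁻ x, ENNReal.ofReal (sectionSqNorm P (centeredKernel P k) x ^ 2) ∂P)
        / ((n : ℝ≥0∞) * ENNReal.ofReal (∫ x, sectionSqNorm P (centeredKernel P k) x ∂P) ^ 2)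
      ≤ nullRatio P k n := by
  have hκ := measurable_centeredKernel (P := P) hk
  rw [lintegral_ofReal_sectionSqNorm_sq (fun x => hκ.of_uncurry_left) (h.ae_memLp hκ), nullRatio,
    defRatio, integral_expectedProduct_self]
  split_ifs with hden
  · exact le_top
  · rw [sq (n : ℝ≥0∞), mul_assoc, ← ENNReal.mul_div_mul_left _ _
      (Nat.cast_ne_zero.2 hn) (ENNReal.natCast_ne_top n)]
    gcongr
    exact le_add_self

theorem IsSpectralDecomposition.integrable_sectionSqNorm_sq_of_nullRatio_ne_top
    (h : IsSpectralDecomposition P (centeredKernel P k) lam φ)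
    (hk : Measurable (Function.uncurry k)) (hr : nullRatio P k n ≠ ∞) :
    Integrable (fun x => sectionSqNorm P (centeredKernel P k) x ^ 2) P := by
  have hmeas : Measurable fun x => sectionSqNorm P (centeredKernel P k) x ^ 2 :=
    ((StronglyMeasurable.integral_prod_right (f := fun x y => centeredKernel P k x y ^ 2)
      ((measurable_centeredKernel hk).pow_const 2).stronglyMeasurable).measurable).pow_const 2
  refine (lintegral_ofReal_ne_top_iff_integrable hmeas.aestronglyMeasurable
    (ae_of_all _ fun x => sq_nonneg _)).1 fun htop => hr (top_le_iff.1 ?_)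
  have hle := h.lintegral_div_le_nullRatio hk (denominator_ne_zero_of_nullRatio_ne_top hr).1
  rwa [htop, ENNReal.top_div_of_ne_top (by finiteness)] at hle

theorem IsSpectralDecomposition.ofReal_div_le_nullRatio
    (h : IsSpectralDecomposition P (centeredKernel P k) lam φ)
    (hk : Measurable (Function.uncurry k)) (hr : nullRatio P k n ≠ ∞) :
    ENNReal.ofReal ((n : ℝ)⁻¹ * ((∫ x, sectionSqNorm P (centeredKernel P k) x ^ 2 ∂P)
      / (∫ x, sectionSqNorm P (centeredKernel P k) x ∂P) ^ 2)) ≤ nullRatio P k n := by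
  obtain ⟨hn, hσ⟩ := denominator_ne_zero_of_nullRatio_ne_top hr
  have hn' : (0 : ℝ) < n := Nat.cast_pos.2 (Nat.pos_of_ne_zero hn)
  refine le_trans (le_of_eq ?_) (h.lintegral_div_le_nullRatio hk hn)
  rw [← ofReal_integral_eq_lintegral_ofReal
      (h.integrable_sectionSqNorm_sq_of_nullRatio_ne_top hk hr) (ae_of_all _ fun x => sq_nonneg _),
    ← ENNReal.ofReal_natCast, ← ENNReal.ofReal_pow hσ.le, ← ENNReal.ofReal_mul hn'.le,
    ← ENNReal.ofReal_div_of_pos (by positivity)]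
  congr 1
  field_simp

end NullRatio

section Witness

/-- The weights of the observations of the two samples in the witness function. -/
noncomputable def witnessWeight (n₁ n₂ : ℕ) : Fin n₁ ⊕ Fin n₂ → ℝ :=
  Sum.elim (fun _ => (n₁ : ℝ)⁻¹) (fun _ => -(n₂ : ℝ)⁻¹)

variable {n₁ n₂ : ℕ}

theorem exists_witness_eq_kernelCombination_add {𝒳 : Type*} [MeasurableSpace 𝒳] (h₁ : n₁ ≠ 0)
    (h₂ : n₂ ≠ 0) (P : Measure 𝒳) (k : 𝒳 → 𝒳 → ℝ) (z : Fin n₁ ⊕ Fin n₂ → 𝒳) :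
    ∃ c : ℝ, witness k (MeasurableEquiv.sumPiEquivProdPi (fun _ => 𝒳) z)
      = fun x => kernelCombination (centeredKernel P k) (witnessWeight n₁ n₂) z x + c := by
  have h₁' : (n₁ : ℝ) ≠ 0 := Nat.cast_ne_zero.2 h₁
  have h₂' : (n₂ : ℝ) ≠ 0 := Nat.cast_ne_zero.2 h₂
  refine ⟨(n₁ : ℝ)⁻¹ * ∑ i, ∫ b, k (z (Sum.inl i)) b ∂P
    - (n₂ : ℝ)⁻¹ * ∑ i, ∫ b, k (z (Sum.inr i)) b ∂P, funext fun x => ?_⟩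
  simp only [witness, kernelCombination, witnessWeight, centeredKernel, Fintype.sum_sum_type,
    Sum.elim_inl, Sum.elim_inr, MeasurableEquiv.coe_sumPiEquivProdPi, Equiv.sumPiEquivProdPi,
    Equiv.coe_fn_mk, ← Finset.mul_sum, Finset.sum_add_distrib, Finset.sum_sub_distrib,
    Finset.sum_const, Finset.card_univ, Fintype.card_fin, nsmul_eq_mul]
  field_simp
  ring

theorem sum_witnessWeight_sq (h₁ : n₁ ≠ 0) (h₂ : n₂ ≠ 0) :
    ∑ j, witnessWeight n₁ n₂ j ^ 2 = (n₁ : ℝ)⁻¹ + (n₂ : ℝ)⁻¹ := by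
  have h₁' : (n₁ : ℝ) ≠ 0 := Nat.cast_ne_zero.2 h₁
  have h₂' : (n₂ : ℝ) ≠ 0 := Nat.cast_ne_zero.2 h₂
  simp only [witnessWeight, Fintype.sum_sum_type, Sum.elim_inl, Sum.elim_inr, Finset.sum_const,
    Finset.card_univ, Fintype.card_fin, nsmul_eq_mul]
  field_simp

theorem sum_witnessWeight_pow_four (h₁ : n₁ ≠ 0) (h₂ : n₂ ≠ 0) :
    ∑ j, witnessWeight n₁ n₂ j ^ 4 = (n₁ : ℝ)⁻¹ ^ 3 + (n₂ : ℝ)⁻¹ ^ 3 := by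
  have h₁' : (n₁ : ℝ) ≠ 0 := Nat.cast_ne_zero.2 h₁
  have h₂' : (n₂ : ℝ) ≠ 0 := Nat.cast_ne_zero.2 h₂
  simp only [witnessWeight, Fintype.sum_sum_type, Sum.elim_inl, Sum.elim_inr, Finset.sum_const,
    Finset.card_univ, Fintype.card_fin, nsmul_eq_mul]
  field_simp

theorem sum_witnessWeight_pow_four_div_le (h₁ : n₁ ≠ 0) (h₂ : n₂ ≠ 0) :
    (∑ j, witnessWeight n₁ n₂ j ^ 4) / (∑ j, witnessWeight n₁ n₂ j ^ 2) ^ 2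
      ≤ (n₁ : ℝ)⁻¹ + (n₂ : ℝ)⁻¹ := by
  rw [sum_witnessWeight_sq h₁ h₂, sum_witnessWeight_pow_four h₁ h₂]
  have hp : (0 : ℝ) < (n₁ : ℝ)⁻¹ := inv_pos.2 (Nat.cast_pos.2 (Nat.pos_of_ne_zero h₁))
  have hq : (0 : ℝ) < (n₂ : ℝ)⁻¹ := inv_pos.2 (Nat.cast_pos.2 (Nat.pos_of_ne_zero h₂))
  rw [div_le_iff₀ (by positivity), ← pow_succ']
  exact pow_add_pow_le hp.le hq.le three_ne_zero

end Witness

theorem mul_le_of_le_defRatio {a b c : ℝ≥0∞} (hb : b ≠ 0) (h : c ≤ defRatio a b) : c * b ≤ a := by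
  rw [defRatio, if_neg hb] at h
  exact ENNReal.mul_le_of_le_div h

namespace LinearSmoother

variable {J K 𝒳 𝒱 ι : Type*} [Fintype J] [Fintype K] [MeasurableSpace 𝒳] [MeasurableSpace 𝒱]
  {S : LinearSmoother K 𝒳 𝒱} {ρ : Measure (𝒳 × 𝒱)} {lam : ι → ℝ} {φ : ι → 𝒳 → ℝ}

theorem mul_le_condMSE_or_variance_le {f : 𝒳 → ℝ} {ε r : ℝ} (hε : 0 ≤ ε) (hr : 0 ≤ r)
    (hf : ENNReal.ofReal ε ≤ S.crossFitRatio ρ f) :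
    ENNReal.ofReal (ε * r) ≤ S.condMSE ρ f ∨ Var[f; ρ.fst] ≤ r := by
  refine or_iff_not_imp_right.2 fun hvar => ?_
  have hlt : r < Var[f; ρ.fst] := not_le.1 hvar
  calc ENNReal.ofReal (ε * r) ≤ ENNReal.ofReal ε * ENNReal.ofReal Var[f; ρ.fst] := by
        rw [ENNReal.ofReal_mul hε]
        gcongr
    _ ≤ S.condMSE ρ f := mul_le_of_le_defRatio (by simpa using hr.trans_lt hlt) hf

variable [IsProbabilityMeasure ρ]

theorem measure_le_crossFitRatio_kernelCombination_le (S : LinearSmoother K 𝒳 𝒱)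
    {κ : 𝒳 → 𝒳 → ℝ} (h : IsSpectralDecomposition ρ.fst κ lam φ)
    (hκ : Measurable (Function.uncurry κ)) (hright : ∀ᵐ x ∂ρ.fst, ∫ y, κ x y ∂ρ.fst = 0)
    (hleft : ∀ᵐ y ∂ρ.fst, ∫ x, κ x y ∂ρ.fst = 0)
    (hG : Integrable (fun x => sectionSqNorm ρ.fst κ x ^ 2) ρ.fst)
    (hσ : 0 < ∫ x, sectionSqNorm ρ.fst κ x ∂ρ.fst) {a : J → ℝ} (ha : 0 < ∑ j, a j ^ 2)
    {ε u : ℝ} (hε : 0 < ε) (hu : 0 < u) :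
    (Measure.pi fun _ : J => ρ.fst)
        {z | ENNReal.ofReal ε ≤ S.crossFitRatio ρ (kernelCombination κ a z)}
      ≤ ENNReal.ofReal (u / ε) * (⨆ i, S.condMSE ρ (φ i))
        + ENNReal.ofReal (smallBallConst * ((√(1 + u))⁻¹
          + u ^ 2 * ((∑ j, a j ^ 4) / (∑ j, a j ^ 2) ^ 2
            * ((∫ x, sectionSqNorm ρ.fst κ x ^ 2 ∂ρ.fst)
              / (∫ x, sectionSqNorm ρ.fst κ x ∂ρ.fst) ^ 2)))) := by
  obtain ⟨r, hr, hratio⟩ :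
      ∃ r > 0, (∑ j, a j ^ 2) * (∫ x, sectionSqNorm ρ.fst κ x ∂ρ.fst) / r = u :=
    ⟨_, div_pos (mul_pos ha hσ) hu, div_div_cancel₀ (mul_pos ha hσ).ne'⟩
  have hεr : 0 < ε * r := mul_pos hε hr
  have hnum := S.measure_le_condMSE_kernelCombination_le h hκ hleft a
    (ENNReal.ofReal_pos.2 hεr).ne' ENNReal.ofReal_ne_top
  have hden := h.measureReal_variance_kernelCombination_le hκ hright hleft hG a hr
  have hsub : {z | ENNReal.ofReal ε ≤ S.crossFitRatio ρ (kernelCombination κ a z)}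
      ⊆ {z : J → 𝒳 | ENNReal.ofReal (ε * r) ≤ S.condMSE ρ (kernelCombination κ a z)}
        ∪ {z | Var[kernelCombination κ a z; ρ.fst] ≤ r} :=
    fun z hz => mul_le_condMSE_or_variance_le hε.le hr.le hz
  refine (measure_mono hsub).trans ((measure_union_le _ _).trans (add_le_add ?_ ?_))
  · refine hnum.trans (le_of_eq ?_)
    rw [← mul_assoc, ← ENNReal.ofReal_mul ha.le, ENNReal.mul_div_right_comm,
      ← ENNReal.ofReal_div_of_pos hεr, ← hratio, div_div, mul_comm r]
  · rw [← ofReal_measureReal]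
    refine ENNReal.ofReal_le_ofReal (hden.trans (le_of_eq ?_))
    rw [← hratio]
    field_simp

theorem AffineEquivariant.ae_crossFitRatio_witness {k : 𝒳 → 𝒳 → ℝ}
    (hS : S.AffineEquivariant ρ)
    (h : IsSpectralDecomposition ρ.fst (centeredKernel ρ.fst k) lam φ)
    (hk : Measurable (Function.uncurry k)) {n₁ n₂ : ℕ} (h₁ : n₁ ≠ 0) (h₂ : n₂ ≠ 0) :
    ∀ᵐ z ∂(Measure.pi fun _ : Fin n₁ ⊕ Fin n₂ => ρ.fst),
      S.crossFitRatio ρ (witness k (MeasurableEquiv.sumPiEquivProdPi (fun _ => 𝒳) z))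
        = S.crossFitRatio ρ
          (kernelCombination (centeredKernel ρ.fst k) (witnessWeight n₁ n₂) z) := by
  have hκ := measurable_centeredKernel (P := ρ.fst) hk
  filter_upwards [ae_pi_forall (J := Fin n₁ ⊕ Fin n₂) (h.ae_memLp hκ)] with z hz
  obtain ⟨c, hc⟩ := exists_witness_eq_kernelCombination_add h₁ h₂ ρ.fst k z
  rw [hc]
  exact hS.crossFitRatio_add_const
    (Finset.measurable_sum _ fun j _ => hκ.of_uncurry_left.const_mul _)
    (integrable_finsetSum _ fun j _ => ((hz j).integrable one_le_two).const_mul _) c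

theorem AffineEquivariant.witnessLaw_le_crossFitRatio_le {k : 𝒳 → 𝒳 → ℝ}
    (hS : S.AffineEquivariant ρ)
    (h : IsSpectralDecomposition ρ.fst (centeredKernel ρ.fst k) lam φ)
    (hk : Measurable (Function.uncurry k))
    (hint : Integrable (Function.uncurry k) (ρ.fst.prod ρ.fst)) {n₁ n₂ : ℕ}
    (hr₁ : nullRatio ρ.fst k n₁ ≠ ∞) (hr₂ : nullRatio ρ.fst k n₂ ≠ ∞) {ε u : ℝ} (hε : 0 < ε)
    (hu : 0 < u) :
    witnessLaw ρ.fst ρ.fst n₁ n₂ {z | ENNReal.ofReal ε ≤ S.crossFitRatio ρ (witness k z)}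
      ≤ ENNReal.ofReal (u / ε) * (⨆ i, S.condMSE ρ (φ i))
        + (ENNReal.ofReal (smallBallConst * (√(1 + u))⁻¹)
          + ENNReal.ofReal (smallBallConst * u ^ 2)
            * (nullRatio ρ.fst k n₁ + nullRatio ρ.fst k n₂)) := by
  obtain ⟨h₁, hσ⟩ := denominator_ne_zero_of_nullRatio_ne_top hr₁
  obtain ⟨h₂, -⟩ := denominator_ne_zero_of_nullRatio_ne_top hr₂
  have hA : 0 < ∑ j, witnessWeight n₁ n₂ j ^ 2 := by
    rw [sum_witnessWeight_sq h₁ h₂]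
    positivity
  have hmp : MeasurePreserving (MeasurableEquiv.sumPiEquivProdPi fun _ : Fin n₁ ⊕ Fin n₂ => 𝒳)
      (Measure.pi fun _ => ρ.fst) (witnessLaw ρ.fst ρ.fst n₁ n₂) :=
    measurePreserving_sumPiEquivProdPi fun _ => ρ.fst
  rw [← hmp.measure_preimage_equiv]
  refine (measure_mono_ae ((hS.ae_crossFitRatio_witness h hk h₁ h₂).mono
    fun z hz hε_le => le_of_le_of_eq hε_le hz)).trans ?_
  refine (S.measure_le_crossFitRatio_kernelCombination_le h (measurable_centeredKernel hk)
    (integral_centeredKernel_right hint) (integral_centeredKernel_left hint)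
    (h.integrable_sectionSqNorm_sq_of_nullRatio_ne_top hk hr₁) hσ hA hε hu).trans ?_
  gcongr
  set G := ∫ x, sectionSqNorm ρ.fst (centeredKernel ρ.fst k) x ^ 2 ∂ρ.fst
  set σ := ∫ x, sectionSqNorm ρ.fst (centeredKernel ρ.fst k) x ∂ρ.fst
  have hc := smallBallConst_nonneg
  have : 0 ≤ G / σ ^ 2 := div_nonneg (integral_nonneg fun x => sq_nonneg _) (sq_nonneg _)
  calc _ ≤ ENNReal.ofReal (smallBallConst * ((√(1 + u))⁻¹
          + u ^ 2 * (((n₁ : ℝ)⁻¹ + (n₂ : ℝ)⁻¹) * (G / σ ^ 2)))) := by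
        gcongr
        exact sum_witnessWeight_pow_four_div_le h₁ h₂
    _ = ENNReal.ofReal (smallBallConst * (√(1 + u))⁻¹) + ENNReal.ofReal (smallBallConst * u ^ 2)
          * (ENNReal.ofReal ((n₁ : ℝ)⁻¹ * (G / σ ^ 2))
            + ENNReal.ofReal ((n₂ : ℝ)⁻¹ * (G / σ ^ 2))) := by
        rw [← ENNReal.ofReal_add (by positivity) (by positivity),
          ← ENNReal.ofReal_mul (by positivity), ← ENNReal.ofReal_add (by positivity)
          (by positivity)]
        ring_nf
    _ ≤ _ := by
        gcongr
        exacts [h.ofReal_div_le_nullRatio hk hr₁, h.ofReal_div_le_nullRatio hk hr₂]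

end LinearSmoother

theorem tendsto_ofReal_const_mul_inv_sqrt_one_add (c : ℝ) :
    Tendsto (fun u : ℝ => ENNReal.ofReal (c * (√(1 + u))⁻¹)) atTop (𝓝 0) := by
  have hsqrt : Tendsto (fun u : ℝ => √(1 + u)) atTop atTop :=
    Real.tendsto_sqrt_atTop.comp (tendsto_atTop_add_const_left _ _ tendsto_id)
  simpa using ENNReal.tendsto_ofReal (hsqrt.inv_tendsto_atTop.const_mul c)

theorem mainTheorem8_general {𝒳 𝒱 ι K : ℕ → Type*} [∀ N, MeasurableSpace (𝒳 N)]
    [∀ N, MeasurableSpace (𝒱 N)] [∀ N, Fintype (K N)] {n₁ n₂ : ℕ → ℕ}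
    {P : ∀ N, Measure (𝒳 N)} (ρ : ∀ N, Measure (𝒳 N × 𝒱 N)) [∀ N, IsProbabilityMeasure (ρ N)]
    (hρ : ∀ N, (ρ N).fst = P N) {k : ∀ N, 𝒳 N → 𝒳 N → ℝ}
    (hk : ∀ N, Measurable (Function.uncurry (k N)))
    (hint : ∀ N, Integrable (Function.uncurry (k N)) ((P N).prod (P N)))
    (hmom₁ : Tendsto (fun N => nullRatio (P N) (k N) (n₁ N)) atTop (𝓝 0))
    (hmom₂ : Tendsto (fun N => nullRatio (P N) (k N) (n₂ N)) atTop (𝓝 0))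
    {lam : ∀ N, ι N → ℝ} {φ : ∀ N, ι N → 𝒳 N → ℝ}
    (hspec : ∀ N, IsSpectralDecomposition (P N) (centeredKernel (P N) (k N)) (lam N) (φ N))
    (S : ∀ N, LinearSmoother (K N) (𝒳 N) (𝒱 N)) (hS : ∀ N, (S N).AffineEquivariant (ρ N))
    (hΔ : Tendsto (fun N => ⨆ i, (S N).condMSE (ρ N) (φ N i)) atTop (𝓝 0)) :
    IsLittleOP (fun N => witnessLaw (P N) (P N) (n₁ N) (n₂ N))
      fun N z => (S N).crossFitRatio (ρ N) (witness (k N) z) := by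
  obtain rfl : (fun N => (ρ N).fst) = P := funext hρ
  refine fun ε hε => ENNReal.tendsto_nhds_zero.2 fun η hη => ?_
  obtain ⟨u, hu, huη⟩ := ((eventually_gt_atTop 0).and
    ((tendsto_ofReal_const_mul_inv_sqrt_one_add smallBallConst).eventually
      (gt_mem_nhds hη))).exists
  have hlim := (ENNReal.Tendsto.const_mul hΔ (a := ENNReal.ofReal (u / ε))
    (.inr ENNReal.ofReal_ne_top)).add ((tendsto_const_nhds
      (x := ENNReal.ofReal (smallBallConst * (√(1 + u))⁻¹))).add
        (ENNReal.Tendsto.const_mul (hmom₁.add hmom₂)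
          (a := ENNReal.ofReal (smallBallConst * u ^ 2)) (.inr ENNReal.ofReal_ne_top)))
  simp only [add_zero, mul_zero, zero_add] at hlim
  filter_upwards [hlim.eventually (gt_mem_nhds huη),
    hmom₁.eventually (gt_mem_nhds ENNReal.zero_lt_top),
    hmom₂.eventually (gt_mem_nhds ENNReal.zero_lt_top)] with N hN hr₁ hr₂
  exact ((hS N).witnessLaw_le_crossFitRatio_le (hspec N) (hk N) (hint N) hr₁.ne hr₂.ne hε
    hu).trans hN.le

theorem mainTheorem8
    {𝒳 𝒱 𝒲 ι : ℕ → Type*}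
    [∀ N, MeasurableSpace (𝒳 N)] [∀ N, MeasurableSpace (𝒱 N)] [∀ N, MeasurableSpace (𝒲 N)]
    [∀ N, Countable (ι N)]
    -- labeled sample sizes `n₁, n₂` and unlabeled sample sizes `m₁, m₂`
    (n₁ n₂ m₁ m₂ : ℕ → ℕ)
    (hn : Tendsto (fun N => min (n₁ N) (n₂ N)) atTop atTop)
    (hnm₁ : (fun N => (n₁ N : ℝ)) =Θ[atTop] fun N => (m₁ N : ℝ))
    (hnm₂ : (fun N => (n₂ N : ℝ)) =Θ[atTop] fun N => (m₂ N : ℝ))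
    -- the laws of `(X, V)` and `(Y, W)`
    (PXV : ∀ N, Measure (𝒳 N × 𝒱 N)) [∀ N, IsProbabilityMeasure (PXV N)]
    (PYW : ∀ N, Measure (𝒳 N × 𝒲 N)) [∀ N, IsProbabilityMeasure (PYW N)]
    -- the null hypothesis `P_X = P_Y`
    (hnull : ∀ N, (PXV N).fst = (PYW N).fst)
    -- the kernel, with finite Bochner integral of `‖k(x, ·)‖ = √k(x, x)`
    (k : ∀ N, 𝒳 N → 𝒳 N → ℝ)
    (hk_meas : ∀ N, Measurable (Function.uncurry (k N)))
    (hk_pos : ∀ N, IsPosDefKernel (k N))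
    (hk_int : ∀ N, Integrable (fun x => Real.sqrt (k N x x)) (PXV N).fst)
    -- the null moment condition, for `X` with `n₁` and for `Y` with `n₂`
    (hmomX : Tendsto (fun N => nullRatio (PXV N).fst (k N) (n₁ N)) atTop (𝓝 0))
    (hmomY : Tendsto (fun N => nullRatio (PYW N).fst (k N) (n₂ N)) atTop (𝓝 0))
    -- the spectral decomposition of the centered kernel
    (lam : ∀ N, ι N → ℝ) (φ : ∀ N, ι N → 𝒳 N → ℝ)
    (hspec : ∀ N, IsSpectralDecomposition (PXV N).fst (centeredKernel (PXV N).fst (k N))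
      (lam N) (φ N))
    -- the linear smoothers trained on the two folds of each labeled sample
    (SX : ∀ N (b : Bool), LinearSmoother (Fold (n₁ N) b) (𝒳 N) (𝒱 N))
    (SY : ∀ N (b : Bool), LinearSmoother (Fold (n₂ N) b) (𝒳 N) (𝒲 N))
    (hSX : ∀ N b, (SX N b).AffineEquivariant (PXV N))
    (hSY : ∀ N b, (SY N b).AffineEquivariant (PYW N))
    (hΔX : ∀ b, Tendsto (fun N => ⨆ i, (SX N b).condMSE (PXV N) (φ N i)) atTop (𝓝 0))
    (hΔY : ∀ b, Tendsto (fun N => ⨆ i, (SY N b).condMSE (PYW N) (φ N i)) atTop (𝓝 0)) :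
    (∀ b, IsLittleOP (fun N => witnessLaw (PXV N).fst (PYW N).fst (n₁ N) (n₂ N))
      fun N z => (SX N b).crossFitRatio (PXV N) (witness (k N) z)) ∧
    (∀ b, IsLittleOP (fun N => witnessLaw (PXV N).fst (PYW N).fst (n₁ N) (n₂ N))
      fun N z => (SY N b).crossFitRatio (PYW N) (witness (k N) z)) := by
  have hint N := (hk_pos N).integrable_uncurry (hk_meas N) (hk_int N)
  simp_rw [← hnull] at hmomY ⊢
  exact ⟨fun b => mainTheorem8_general PXV (fun _ => rfl) hk_meas hint hmomX hmomY hspec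
      (fun N => SX N b) (fun N => hSX N b) (hΔX b),
    fun b => mainTheorem8_general PYW (fun N => (hnull N).symm) hk_meas hint hmomX hmomY hspec
      (fun N => SY N b) (fun N => hSY N b) (hΔY b)⟩
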